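/- Let $d\ge 1$ and write $B_r(x)$ for the open Euclidean ball in $\mathbb{R}^d$. Let $P,Q$ be probability measures on $\mathbb{R}^d$ with supports $\Omega,\Omega'$. Assume that $\Omega$ is compact and convex, that $P$ has a Lebesgue density $\rho$ with $0<\lambda_P\le\rho\le\Lambda_P<\infty$ on $\Omega$, and that $\Omega'$ is compact. Let $c:\mathbb{R}^d\times\mathbb{R}^d\to\mathbb{R}$ satisfy $|c(x,y)-c(x',y')|\le L(\|x-x'\|+\|y-y'\|)$ with $L>0$ (in particular, any $c$ that is $L$-Lipschitz for the Euclidean norm is allowed), and let $\varepsilon>0$. Define $$\mathrm{QOT}_\varepsilon(P,Q)=\inf_{\pi\in\Pi(P,Q)}\int c\,d\pi+\frac{\varepsilon}{2}\Big\|\frac{d\pi}{d(P\otimes Q)}\Big\|^2_{L^2(P\otimes Q)},$$ where $\Pi(P,Q)$ is the set of couplings of $P$ and $Q$ and the last term is $+\infty$ if $\pi\not\ll P\otimes Q$. With $(f\oplus g)(x,y)=f(x)+g(y)$ and $(t)_+=\max(t,0)$, define the dual objective on the Hilbert space $L^2(P)\times L^2(Q)$ by $$\Gamma(f,g)=\int\Big(f\oplus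 g-\frac{1}{2\varepsilon}(f\oplus g-c)_+^2\Big)\,d(P\otimes Q),$$ and let $\mathrm{D}\Gamma$ be its gradient. There is a constant $\delta\in(0,1]$, depending only on $\Omega$ and $\lambda_P$, such that $P(B_r(x))\ge\delta\min(r^d,1)$ for all $x\in\Omega$ and $r>0$. Let $\delta_P\in(0,1]$ be any constant with this property for the given $P$ and set $$\gamma_\varepsilon=16\Big(\delta_P^{-1}\max\Big(\frac{8L}{\varepsilon},1\Big)^d\Big)\frac{\Lambda_P^2}{\lambda_P^2}\,\frac{\lceil 8L\,\mathrm{diam}(\Omega)/\varepsilon\rceil^{d+2}}{\inf_{y\in\Omega'}Q\big(B_{\varepsilon/(8L)}(y)\big)}.$$ Then $\mathrm{QOT}_\varepsilon(P,Q)$ is finite. Moreover, let $(f_*,g_*)$ be any maximizer of $\Gamma$ over $L^2(P)\times L^2(Q)$. Then for every $(f,g)\in L^\infty(P)\times L^\infty(Q)$, the function $\Gamma$ is Fréchet differentiable at $(f,g)$, the norm $\|f\oplus g-f_*\oplus g_*\|_\infty$ in $L^\infty(P\otimes Q)$ is finite, and the following hold: (i) error bound: $$\|f\oplus g-f_*\oplus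 g_*\|_{L^2(P\otimes Q)}\le\gamma_\varepsilon\max\big(\|f\oplus g-f_*\oplus g_*\|_\infty,\varepsilon\big)\,\|\mathrm{D}\Gamma(f,g)\|_{L^2(P)\times L^2(Q)};$$ (ii) PL inequality: $$\|\mathrm{D}\Gamma(f,g)\|^2_{L^2(P)\times L^2(Q)}\ge\frac{\mathrm{QOT}_\varepsilon(P,Q)-\Gamma(f,g)}{\gamma_\varepsilon\max\big(\|f\oplus g-f_*\oplus g_*\|_\infty,\varepsilon\big)}.$$ -/

import Mathlib

open MeasureTheory Topology Set
open scoped ENNReal NNReal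

noncomputable section

namespace QOT

/-- The ambient space `ℝ^d` with its Euclidean norm. -/
abbrev Pt (d : ℕ) : Type := EuclideanSpace ℝ (Fin d)

/-- `P` has density `ρ` with respect to Lebesgue measure, and `lam ≤ ρ ≤ Lam` on the support
of `P`. -/
structure HasDensityBounds {d : ℕ} (P : Measure (Pt d)) (ρ : Pt d → ℝ) (lam Lam : ℝ) : Prop where
  measurable : Measurable ρ
  density : P = volume.withDensity (fun x => ENNReal.ofReal (ρ x))
  bounds : ∀ x ∈ P.support, lam ≤ ρ x ∧ ρ x ≤ Lam

/-- `δ ∈ (0, 1]` is a constant with `P (B_r(x)) ≥ δ * min (r ^ d) 1` for all `r > 0` and all `x`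
in the support of `P`. -/
structure IsBallMassConstant {d : ℕ} (P : Measure (Pt d)) (δ : ℝ) : Prop where
  pos : 0 < δ
  le_one : δ ≤ 1
  le_ball : ∀ x ∈ P.support, ∀ r : ℝ, 0 < r → δ * min (r ^ d) 1 ≤ P.real (Metric.ball x r)

/-- `π` is a coupling of `P` and `Q`. -/
structure IsCoupling {d : ℕ} (P Q : Measure (Pt d)) (π : Measure (Pt d × Pt d)) : Prop where
  map_fst : π.map Prod.fst = P
  map_snd : π.map Prod.snd = Q

open Classical in
/-- The squared `L²(μ)`-norm of the density `dπ/dμ`, with value `∞` if `π` is not absolutely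
continuous with respect to `μ` (or if the density is not square integrable). -/
def sqNormDensity {X : Type*} [MeasurableSpace X] (π μ : Measure X) : ℝ≥0∞ :=
  if π ≪ μ then ∫⁻ z, (π.rnDeriv μ z) ^ 2 ∂μ else ∞

/-- The value of the quadratically regularized optimal transport problem: the infimum over all
couplings `π` of `∫ c dπ + (ε / 2) ‖dπ/d(P ⊗ Q)‖²`. -/
def value {d : ℕ} (P Q : Measure (Pt d)) (c : Pt d → Pt d → ℝ) (ε : ℝ) : EReal :=
  ⨅ (π : Measure (Pt d × Pt d)) (_ : IsCoupling P Q π),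
    (((∫ z, c z.1 z.2 ∂π : ℝ) : EReal)
      + ((ENNReal.ofReal (ε / 2) * sqNormDensity π (P.prod Q) : ℝ≥0∞) : EReal))

/-- The Hilbert space `L²(P) × L²(Q)`, with `‖(u, v)‖² = ‖u‖² + ‖v‖²`. -/
abbrev DualSpace {d : ℕ} (P Q : Measure (Pt d)) : Type :=
  WithLp 2 (Lp ℝ 2 P × Lp ℝ 2 Q)

/-- The function `f ⊕ g`, that is `(x, y) ↦ f x + g y`, for `p = (f, g)`. -/
def oplus {d : ℕ} {P Q : Measure (Pt d)} (p : DualSpace P Q) : Pt d × Pt d → ℝ :=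
  fun z => p.fst z.1 + p.snd z.2

/-- The dual objective `Γ(f, g) = ∫ (f ⊕ g - (1 / (2 ε)) ((f ⊕ g - c)₊)²) d(P ⊗ Q)` on
`L²(P) × L²(Q)`. -/
def Gam {d : ℕ} (P Q : Measure (Pt d)) (c : Pt d → Pt d → ℝ) (ε : ℝ) (p : DualSpace P Q) : ℝ :=
  ∫ z, (oplus p z - 1 / (2 * ε) * (max (oplus p z - c z.1 z.2) 0) ^ 2) ∂(P.prod Q)

/-- `p = (f, g)` maximizes the dual objective over `L²(P) × L²(Q)`. -/
def IsDualOptimizer {d : ℕ} (P Q : Measure (Pt d)) (c : Pt d → Pt d → ℝ) (ε : ℝ)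
    (p : DualSpace P Q) : Prop :=
  ∀ q : DualSpace P Q, Gam P Q c ε q ≤ Gam P Q c ε p

/-- The constant `γ_ε`. -/
def gammaConst {d : ℕ} (P Q : Measure (Pt d)) (δ lam Lam L ε : ℝ) : ℝ :=
  16 * (δ⁻¹ * (max (8 * L / ε) 1) ^ d) * (Lam ^ 2 / lam ^ 2)
    * (((⌈8 * L * Metric.diam P.support / ε⌉₊ : ℕ) : ℝ) ^ (d + 2)
      / ⨅ y : Q.support, Q.real (Metric.ball (y : Pt d) (ε / (8 * L))))

end QOT

end

/-!
Write `h = f ⊕ g - f_* ⊕ g_*` and `ξ = f_* ⊕ g_* - c`. The dual objective is concave, with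
derivative `q ↦ ∫ (1 - (f ⊕ g - c)₊ / ε) (q₁ ⊕ q₂) d(P ⊗ Q)`, which vanishes at the optimizer.
Testing it with `h` gives `-DΓ(f, g) h = ε⁻¹ ∫ ((ξ + h)₊ - ξ₊) h`. The integrand is nonnegative,
and on `{ξ ≥ ε / 2}` it is at least `ε h² / (2 max(‖h‖_∞, ε))`. The error bound follows once
`∫ h²` is controlled by the integral of `h²` over `{ξ ≥ ε / 2}`; this is
`integral_sq_oplus_le_level`, which produces the constant `γ_ε`.

For that estimate, the first-order conditions `∫ ξ₊(x, ·) dQ = ε` and `∫ ξ₊(·, y) dP = ε` show that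
the optimal potentials are `L`-Lipschitz (`exists_lipschitzWith_ae_eq`) and that each point of one
space has a partner in the other with `ξ ≥ ε`. Partners persist, with `ξ ≥ ε / 2`, on balls of
radius `r = ε / (8 L)`, whose masses are bounded below. With `h = u ⊕ v`, the increment
`u x - u x' = h(x, y) - h(x', y)` for `|x - x'| ≤ r` is bounded by averaging over common partners
`y`. Increments over longer distances are sums of `N = ⌈diam Ω / r⌉` short ones along a segment;
the change of variables from the endpoints to the endpoints of a step costs `N ^ d`, and this gives
a Poincaré inequality with the factor `N ^ (d + 2)` (`HasDensityBounds.lintegral_sq_sub_le`), hence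
a bound for the variance of `u`. Averaging over partners once more bounds `v`.

The derivative depends on the direction only through `q₁ ⊕ q₂`, so after moving a constant between
the two components its size is `‖DΓ‖ ‖h‖` with the `L²(P ⊗ Q)`-norm of `h`
(`abs_dualDeriv_apply_le_oplus`). Finally, the coupling with density `ξ₊ / ε` has cost
`Γ(f_*, g_*)` (`IsDualOptimizer.value_le_Gam`), and concavity bounds the remaining gap
`Γ(f_*, g_*) - Γ(f, g)` by `‖DΓ‖ ‖h‖`; the error bound turns this into the PL inequality.
-/

noncomputable section

namespace QOT

/-! ### Density bounds and the mass of balls -/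

theorem HasDensityBounds.apply_inter_support {d : ℕ} {P : Measure (Pt d)} {ρ : Pt d → ℝ}
    {lam Lam : ℝ} (h : HasDensityBounds P ρ lam Lam) {s : Set (Pt d)} (hs : MeasurableSet s) :
    P (s ∩ P.support) = ∫⁻ x in s ∩ P.support, ENNReal.ofReal (ρ x) := by
  have hS : MeasurableSet P.support := Measure.isClosed_support.measurableSet
  conv_lhs => rw [h.density]
  rw [withDensity_apply _ (hs.inter (by rw [← h.density]; exact hS)), ← h.density]

theorem HasDensityBounds.le_smul_volume {d : ℕ} {P : Measure (Pt d)} {ρ : Pt d → ℝ} {lam Lam : ℝ}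
    (h : HasDensityBounds P ρ lam Lam) :
    P ≤ ENNReal.ofReal Lam • (volume.restrict P.support : Measure (Pt d)) := by
  refine Measure.le_iff.2 fun s hs => ?_
  have h1 : P s = P (s ∩ P.support) := by
    rw [measure_inter_conull Measure.measure_compl_support]
  rw [h1, h.apply_inter_support hs, Measure.smul_apply, smul_eq_mul,
    Measure.restrict_apply hs, ← setLIntegral_const]
  exact setLIntegral_mono measurable_const
    fun x hx => ENNReal.ofReal_le_ofReal (h.bounds x hx.2).2

theorem HasDensityBounds.smul_volume_le {d : ℕ} {P : Measure (Pt d)} {ρ : Pt d → ℝ} {lam Lam : ℝ}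
    (h : HasDensityBounds P ρ lam Lam) :
    ENNReal.ofReal lam • (volume.restrict P.support : Measure (Pt d)) ≤ P := by
  refine Measure.le_iff.2 fun s hs => ?_
  refine le_trans ?_ (measure_mono (inter_subset_left : s ∩ P.support ⊆ s))
  rw [h.apply_inter_support hs, Measure.smul_apply, smul_eq_mul,
    Measure.restrict_apply hs, ← setLIntegral_const]
  exact setLIntegral_mono h.measurable.ennreal_ofReal
    fun x hx => ENNReal.ofReal_le_ofReal (h.bounds x hx.2).1

/-- The copy of a convex set shrunk by the ratio `t` about one of its points `x` stays in the set
and in the ball of radius `t * D` around `x`, where `D` exceeds the diameter. -/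
theorem homothety_image_subset_ball {d : ℕ} {Ω : Set (Pt d)} (hc : IsCompact Ω)
    (hconv : Convex ℝ Ω) {D : ℝ} (hD : Metric.diam Ω < D) {x : Pt d} (hx : x ∈ Ω) {t : ℝ}
    (ht0 : 0 < t) (ht1 : t ≤ 1) :
    AffineMap.homothety x t '' Ω ⊆ Metric.ball x (t * D) ∩ Ω := by
  rintro _ ⟨y, hy, rfl⟩
  constructor
  · rw [Metric.mem_ball, dist_homothety_center, Real.norm_of_nonneg ht0.le, dist_comm]
    have := Metric.dist_le_diam_of_mem hc.isBounded hy hx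
    exact mul_lt_mul_of_pos_left (by linarith [dist_comm x y]) ht0
  · rw [AffineMap.homothety_eq_lineMap]
    exact hconv.lineMap_mem hx hy ⟨ht0.le, ht1⟩

/-- The constant is `min 1 (lam |Ω| / D ^ d)` with `D` slightly larger than the diameter of `Ω`, by
comparison with homothetic copies of `Ω`. -/
theorem exists_isBallMassConstant {d : ℕ} {Ω : Set (Pt d)} (hc : IsCompact Ω)
    (hconv : Convex ℝ Ω) {lam : ℝ} (hlam : 0 < lam) :
    ∃ δ : ℝ, 0 < δ ∧ δ ≤ 1 ∧
      ∀ (P : Measure (Pt d)) (ρ : Pt d → ℝ) (Lam : ℝ), IsProbabilityMeasure P →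
        P.support = Ω → HasDensityBounds P ρ lam Lam → IsBallMassConstant P δ := by
  rcases eq_or_ne (volume Ω) 0 with h0 | h0
  · -- a null set does not support an absolutely continuous probability measure
    refine ⟨1, one_pos, le_rfl, fun P ρ Lam hP hs hρ => ?_⟩
    have h1 := hρ.le_smul_volume univ
    have h2 := measure_univ (μ := P)
    rw [hs, Measure.smul_apply, Measure.restrict_apply_univ, h0, h2] at h1
    simp at h1
  set D : ℝ := Metric.diam Ω + 1 with hDdef
  have hdiam : 0 ≤ Metric.diam Ω := Metric.diam_nonneg
  have hD : 0 < D := by positivity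
  have hV : 0 < volume.real Ω := ENNReal.toReal_pos h0 hc.measure_lt_top.ne
  set K : ℝ := lam * volume.real Ω / D ^ d with hK
  have hKpos : 0 < K := by positivity
  refine ⟨min 1 K, lt_min one_pos hKpos, min_le_left _ _, fun P ρ Lam hP hs hρ => ?_⟩
  refine ⟨lt_min one_pos hKpos, min_le_left _ _, fun x hx r hr => ?_⟩
  set t : ℝ := min r 1 / D with ht
  have hm : 0 < min r 1 := lt_min hr one_pos
  have ht0 : 0 < t := by positivity
  have ht1 : t ≤ 1 := (div_le_one hD).2 ((min_le_right _ _).trans (by linarith))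
  have hsub := homothety_image_subset_ball hc hconv (D := D) (by linarith) (hs ▸ hx) ht0 ht1
  have htD : t * D = min r 1 := div_mul_cancel₀ _ hD.ne'
  have hvol : volume.real (AffineMap.homothety x t '' Ω) = t ^ d * volume.real Ω := by
    rw [measureReal_def, Measure.addHaar_image_homothety, ENNReal.toReal_mul,
      finrank_euclideanSpace_fin, ENNReal.toReal_ofReal (abs_nonneg _), abs_of_pos (by positivity)]
    rfl
  have hle : lam * (t ^ d * volume.real Ω) ≤ P.real (Metric.ball x r) := by
    have h3 := hρ.smul_volume_le (Metric.ball x r)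
    rw [Measure.smul_apply, smul_eq_mul, Measure.restrict_apply Metric.isOpen_ball.measurableSet,
      hs] at h3
    have h4 : volume (AffineMap.homothety x t '' Ω) ≤ volume (Metric.ball x r ∩ Ω) :=
      measure_mono (hsub.trans (inter_subset_inter_left _
        (Metric.ball_subset_ball (htD ▸ min_le_left _ _))))
    have h5 := ENNReal.toReal_mono (measure_ne_top P _) ((mul_le_mul_right h4 _).trans h3)
    rwa [ENNReal.toReal_mul, ENNReal.toReal_ofReal hlam.le, ← measureReal_def,
      ← measureReal_def, hvol] at h5
  have hpow : min (r ^ d) 1 ≤ (min r 1) ^ d := by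
    rcases le_total r 1 with h | h
    · rw [min_eq_left h]; exact min_le_left _ _
    · rw [min_eq_right h, one_pow]; exact min_le_right _ _
  calc min 1 K * min (r ^ d) 1 ≤ K * (min r 1) ^ d :=
        mul_le_mul (min_le_right _ _) hpow (by positivity) hKpos.le
    _ = lam * (t ^ d * volume.real Ω) := by rw [hK, ht, div_pow]; ring
    _ ≤ _ := hle

/-- The balls of a fixed radius around the points of a compact support have mass bounded below. -/
theorem exists_pos_le_measureReal_ball {d : ℕ} {Q : Measure (Pt d)} [IsFiniteMeasure Q]
    (hQ : IsCompact Q.support) {r : ℝ} (hr : 0 < r) :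
    ∃ m : ℝ, 0 < m ∧ ∀ y ∈ Q.support, m ≤ Q.real (Metric.ball y r) := by
  refine hQ.induction_on (p := fun s => ∃ m : ℝ, 0 < m ∧ ∀ y ∈ s, m ≤ Q.real (Metric.ball y r))
    ⟨1, one_pos, by simp⟩ ?_ ?_ ?_
  · rintro s t hst ⟨m, hm, h⟩
    exact ⟨m, hm, fun y hy => h y (hst hy)⟩
  · rintro s t ⟨m, hm, h⟩ ⟨m', hm', h'⟩
    refine ⟨min m m', lt_min hm hm', ?_⟩
    rintro y (hy | hy)
    · exact (min_le_left _ _).trans (h y hy)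
    · exact (min_le_right _ _).trans (h' y hy)
  · intro x hx
    have hr2 : 0 < r / 2 := by positivity
    have hpos : 0 < Q (Metric.ball x (r / 2)) :=
      Measure.mem_support_iff_forall x |>.1 hx _ (Metric.ball_mem_nhds x hr2)
    refine ⟨Metric.ball x (r / 2), mem_nhdsWithin_of_mem_nhds (Metric.ball_mem_nhds x hr2),
      Q.real (Metric.ball x (r / 2)), ENNReal.toReal_pos hpos.ne' (measure_ne_top _ _),
      fun y hy => measureReal_mono (Metric.ball_subset_ball' ?_)⟩
    rw [Metric.mem_ball, dist_comm] at hy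
    linarith

theorem iInf_measureReal_ball_le {d : ℕ} {Q : Measure (Pt d)} {r : ℝ} {y : Pt d}
    (hy : y ∈ Q.support) :
    ⨅ y : Q.support, Q.real (Metric.ball (y : Pt d) r) ≤ Q.real (Metric.ball y r) :=
  ciInf_le (f := fun y : Q.support => Q.real (Metric.ball (y : Pt d) r))
    ⟨0, by rintro _ ⟨z, rfl⟩; exact measureReal_nonneg⟩ ⟨y, hy⟩

theorem iInf_measureReal_ball_pos {d : ℕ} {Q : Measure (Pt d)} [IsProbabilityMeasure Q]
    (hQ : IsCompact Q.support) {r : ℝ} (hr : 0 < r) :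
    0 < ⨅ y : Q.support, Q.real (Metric.ball (y : Pt d) r) := by
  obtain ⟨m, hm, h⟩ := exists_pos_le_measureReal_ball hQ hr
  have : Nonempty Q.support :=
    (Measure.nonempty_support (IsProbabilityMeasure.ne_zero Q)).to_subtype
  exact hm.trans_le (le_ciInf fun y => h y y.2)

/-- A probability measure with a Lebesgue density is not concentrated at a point. -/
theorem HasDensityBounds.diam_pos {d : ℕ} (hd : 1 ≤ d) {P : Measure (Pt d)}
    [IsProbabilityMeasure P] {ρ : Pt d → ℝ} {lam Lam : ℝ} (h : HasDensityBounds P ρ lam Lam)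
    (hP : IsCompact P.support) : 0 < Metric.diam P.support := by
  by_contra! h0
  have : Nonempty (Fin d) := ⟨⟨0, hd⟩⟩
  have hsub : P.support.Subsingleton := by
    intro x hx y hy
    exact dist_le_zero.1 ((Metric.dist_le_diam_of_mem hP.isBounded hx hy).trans h0)
  have h1 := h.le_smul_volume univ
  rw [Measure.smul_apply, Measure.restrict_apply_univ, hsub.measure_zero, measure_univ] at h1
  simp at h1


/-! ### A nonlocal Poincaré inequality on convex sets -/

/-- The map sending `(x, x')` to the pair of points of the segment from `x` to `x'` at the
parameters `a / N` and `(a + 1) / N` scales Lebesgue measure by `N⁻ᵈ`. -/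
theorem lintegral_lintegral_segment_step {d : ℕ} {N : ℝ} (hN : 0 < N) (a : ℝ)
    {k : Pt d × Pt d → ℝ≥0∞} (hk : Measurable k) :
    ∫⁻ x, ∫⁻ x', k (x + (a / N) • (x' - x), x + ((a + 1) / N) • (x' - x))
      = ENNReal.ofReal (N ^ d) * ∫⁻ z, ∫⁻ z', k (z, z') := by
  -- substitute the increment `w = (x' - x) / N`
  have h1 : ∀ x : Pt d, ∫⁻ x', k (x + (a / N) • (x' - x), x + ((a + 1) / N) • (x' - x))
      = ENNReal.ofReal (N ^ d) * ∫⁻ w, k (x + a • w, x + (a + 1) • w) := by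
    intro x
    have hG : Measurable fun w : Pt d => k (x + a • w, x + (a + 1) • w) := by fun_prop
    have e1 := lintegral_sub_right_eq_self (μ := (volume : Measure (Pt d)))
      (fun w => k (x + (a / N) • w, x + ((a + 1) / N) • w)) x
    have e2 := Measure.map_addHaar_smul (volume : Measure (Pt d)) (inv_ne_zero hN.ne')
    have e3 := lintegral_map (μ := (volume : Measure (Pt d))) hG (measurable_const_smul (N⁻¹ : ℝ))
    rw [e2, lintegral_smul_measure, finrank_euclideanSpace_fin, inv_pow, inv_inv,
      abs_of_pos (by positivity), smul_eq_mul] at e3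
    rw [e1, e3]
    simp only [smul_smul, div_eq_mul_inv]
  simp only [h1]
  rw [lintegral_const_mul _ (by fun_prop)]
  congr 1
  -- translate by `a • w`, for fixed `w`
  rw [lintegral_lintegral_swap (by fun_prop)]
  have h2 : ∀ w : Pt d, ∫⁻ x, k (x + a • w, x + (a + 1) • w) = ∫⁻ z, k (z, z + w) := by
    intro w
    rw [← lintegral_add_right_eq_self (fun z => k (z, z + w)) (a • w)]
    simp only [add_smul, one_smul, add_assoc]
  simp only [h2]
  rw [lintegral_lintegral_swap (by fun_prop)]
  refine lintegral_congr fun z => ?_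
  exact lintegral_add_left_eq_self (fun z' => k (z, z')) z

/-- The squared increment of `u` along a segment is at most `N` times the sum of the squares of
its increments over `N` equal steps. -/
theorem sq_sub_le_mul_sum_steps {d : ℕ} (u : Pt d → ℝ) {N : ℕ} (hN : 0 < N) (x x' : Pt d) :
    (u x - u x') ^ 2 ≤ N * ∑ i ∈ Finset.range N,
      (u (x + ((i : ℝ) / N) • (x' - x)) - u (x + (((i : ℝ) + 1) / N) • (x' - x))) ^ 2 := by
  have hN' : (N : ℝ) ≠ 0 := by positivity
  set w : ℕ → ℝ := fun i => u (x + ((i : ℝ) / N) • (x' - x)) with hw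
  have h1 : u x - u x' = ∑ i ∈ Finset.range N, (w i - w (i + 1)) := by
    rw [Finset.sum_range_sub' w N]
    simp [hw, div_self hN']
  have h2 := sq_sum_le_card_mul_sum_sq (s := Finset.range N) (f := fun i => w i - w (i + 1))
  rw [← h1, Finset.card_range] at h2
  simpa [hw] using h2

/-- The squared increment of `u` restricted to pairs of points of `Ω` at distance at most `r`. -/
def localSqDiff {d : ℕ} (Ω : Set (Pt d)) (r : ℝ) (u : Pt d → ℝ) : Pt d × Pt d → ℝ≥0∞ :=
  indicator {z | z.1 ∈ Ω ∧ z.2 ∈ Ω ∧ dist z.1 z.2 ≤ r}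
    fun z => ENNReal.ofReal ((u z.1 - u z.2) ^ 2)

theorem measurable_localSqDiff {d : ℕ} {Ω : Set (Pt d)} (hΩ : MeasurableSet Ω) (r : ℝ)
    {u : Pt d → ℝ} (hu : Measurable u) : Measurable (localSqDiff Ω r u) := by
  have h : Measurable fun z : Pt d × Pt d => ENNReal.ofReal ((u z.1 - u z.2) ^ 2) := by fun_prop
  refine h.indicator ?_
  exact (measurable_fst hΩ).inter ((measurable_snd hΩ).inter
    (measurableSet_le (measurable_fst.dist measurable_snd) measurable_const))

theorem ofReal_sq_sub_le_sum_localSqDiff {d : ℕ} {Ω : Set (Pt d)} (hconv : Convex ℝ Ω)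
    {r : ℝ} (u : Pt d → ℝ) {N : ℕ} (hN : 0 < N) {x x' : Pt d} (hx : x ∈ Ω) (hx' : x' ∈ Ω)
    (hr : dist x x' ≤ N * r) :
    ENNReal.ofReal ((u x - u x') ^ 2) ≤ N * ∑ i ∈ Finset.range N, localSqDiff Ω r u
      (x + ((i : ℝ) / N) • (x' - x), x + (((i : ℝ) + 1) / N) • (x' - x)) := by
  have hN' : (0 : ℝ) < N := by positivity
  have hmem : ∀ a : ℝ, 0 ≤ a → a ≤ N → x + (a / N) • (x' - x) ∈ Ω := fun a h0 h1 =>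
    hconv.add_smul_sub_mem hx hx' ⟨by positivity, (div_le_one hN').2 h1⟩
  refine (ENNReal.ofReal_le_ofReal (sq_sub_le_mul_sum_steps u hN x x')).trans (le_of_eq ?_)
  rw [ENNReal.ofReal_mul (by positivity), ENNReal.ofReal_natCast,
    ENNReal.ofReal_sum_of_nonneg (fun i _ => sq_nonneg _)]
  congr 1
  refine Finset.sum_congr rfl fun i hi => ?_
  have hi' : (i : ℝ) + 1 ≤ N := by exact_mod_cast Finset.mem_range.1 hi
  rw [localSqDiff, indicator_of_mem]
  refine ⟨hmem _ (by positivity) (by linarith), hmem _ (by positivity) hi', ?_⟩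
  have : (x + ((i : ℝ) / N) • (x' - x)) - (x + (((i : ℝ) + 1) / N) • (x' - x))
      = -((N : ℝ)⁻¹ • (x' - x)) := by
    rw [add_sub_add_left_eq_sub, ← sub_smul, ← neg_smul]; congr 1; field_simp; ring
  change dist (x + ((i : ℝ) / N) • (x' - x)) (x + (((i : ℝ) + 1) / N) • (x' - x)) ≤ r
  rw [dist_eq_norm, this, norm_neg, norm_smul, norm_inv, Real.norm_natCast, ← dist_eq_norm,
    inv_mul_le_iff₀ hN', dist_comm]
  exact hr

/-- Nonlocal Poincaré inequality for Lebesgue measure on a convex set: each pair of points is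
joined by a segment, which is cut into `N` steps of length at most `r`. -/
theorem lintegral_sq_sub_le_localSqDiff {d : ℕ} {Ω : Set (Pt d)} (hΩ : MeasurableSet Ω)
    (hconv : Convex ℝ Ω) {r : ℝ} {u : Pt d → ℝ} (hu : Measurable u) {N : ℕ} (hN : 0 < N)
    (hr : ∀ x ∈ Ω, ∀ x' ∈ Ω, dist x x' ≤ N * r) :
    ∫⁻ x in Ω, ∫⁻ x' in Ω, ENNReal.ofReal ((u x - u x') ^ 2)
      ≤ (N : ℝ≥0∞) ^ (d + 2) * ∫⁻ z in Ω, ∫⁻ z' in Ω, localSqDiff Ω r u (z, z') := by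
  have hk := measurable_localSqDiff hΩ r hu
  calc ∫⁻ x in Ω, ∫⁻ x' in Ω, ENNReal.ofReal ((u x - u x') ^ 2)
      ≤ ∫⁻ x in Ω, ∫⁻ x' in Ω, (N * ∑ i ∈ Finset.range N, localSqDiff Ω r u
          (x + ((i : ℝ) / N) • (x' - x), x + (((i : ℝ) + 1) / N) • (x' - x))) :=
        setLIntegral_mono' hΩ fun x hx => setLIntegral_mono' hΩ fun x' hx' =>
          ofReal_sq_sub_le_sum_localSqDiff hconv u hN hx hx' (hr x hx x' hx')
    _ ≤ ∫⁻ x, ∫⁻ x', (N * ∑ i ∈ Finset.range N, localSqDiff Ω r u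
          (x + ((i : ℝ) / N) • (x' - x), x + (((i : ℝ) + 1) / N) • (x' - x))) :=
        lintegral_mono' Measure.restrict_le_self fun x =>
          lintegral_mono' Measure.restrict_le_self le_rfl
    _ = N * ∑ i ∈ Finset.range N, ∫⁻ x, ∫⁻ x', localSqDiff Ω r u
          (x + ((i : ℝ) / N) • (x' - x), x + (((i : ℝ) + 1) / N) • (x' - x)) := by
        have e : ∀ x : Pt d, ∫⁻ x', (N * ∑ i ∈ Finset.range N, localSqDiff Ω r u
            (x + ((i : ℝ) / N) • (x' - x), x + (((i : ℝ) + 1) / N) • (x' - x)))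
            = N * ∑ i ∈ Finset.range N, ∫⁻ x', localSqDiff Ω r u
            (x + ((i : ℝ) / N) • (x' - x), x + (((i : ℝ) + 1) / N) • (x' - x)) := by
          intro x
          rw [lintegral_const_mul _ (by fun_prop), lintegral_finsetSum _ (by fun_prop)]
        simp only [e]
        rw [lintegral_const_mul _ (by fun_prop), lintegral_finsetSum _ (by fun_prop)]
    _ = (N : ℝ≥0∞) ^ (d + 2) * ∫⁻ z, ∫⁻ z', localSqDiff Ω r u (z, z') := by
        simp only [lintegral_lintegral_segment_step (Nat.cast_pos.2 hN) _ hk, Finset.sum_const,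
          Finset.card_range, nsmul_eq_mul]
        rw [ENNReal.ofReal_pow (by positivity), ENNReal.ofReal_natCast]
        ring
    _ = _ := by
        congr 1
        rw [← lintegral_indicator hΩ]
        refine lintegral_congr fun z => ?_
        by_cases hz : z ∈ Ω
        · rw [indicator_of_mem hz, ← lintegral_indicator hΩ]
          refine lintegral_congr fun z' => ?_
          by_cases hz' : z' ∈ Ω
          · rw [indicator_of_mem hz']
          · rw [indicator_of_notMem hz', localSqDiff, indicator_of_notMem (fun h => hz' h.2.1)]
        · rw [indicator_of_notMem hz]
          simp [localSqDiff, hz]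

/-- Nonlocal Poincaré inequality for a measure with density bounds on a convex support. -/
theorem HasDensityBounds.lintegral_sq_sub_le {d : ℕ} {P : Measure (Pt d)} [SFinite P]
    {ρ : Pt d → ℝ} {lam Lam : ℝ} (h : HasDensityBounds P ρ lam Lam) (hconv : Convex ℝ P.support)
    {r : ℝ} {u : Pt d → ℝ} (hu : Measurable u) {N : ℕ} (hN : 0 < N)
    (hr : ∀ x ∈ P.support, ∀ x' ∈ P.support, dist x x' ≤ N * r) :
    ENNReal.ofReal lam ^ 2 * ∫⁻ x, ∫⁻ x', ENNReal.ofReal ((u x - u x') ^ 2) ∂P ∂P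
      ≤ ENNReal.ofReal Lam ^ 2 * (N : ℝ≥0∞) ^ (d + 2) *
        ∫⁻ z, ∫⁻ z', localSqDiff P.support r u (z, z') ∂P ∂P := by
  have hS : MeasurableSet P.support := Measure.isClosed_support.measurableSet
  have hk := measurable_localSqDiff hS r hu
  have up : ∫⁻ x, ∫⁻ x', ENNReal.ofReal ((u x - u x') ^ 2) ∂P ∂P ≤ ENNReal.ofReal Lam ^ 2 *
      ∫⁻ x in P.support, ∫⁻ x' in P.support, ENNReal.ofReal ((u x - u x') ^ 2) := by
    refine (lintegral_mono' h.le_smul_volume fun x =>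
      lintegral_mono' h.le_smul_volume le_rfl).trans (le_of_eq ?_)
    simp only [lintegral_smul_measure, smul_eq_mul]
    rw [lintegral_const_mul _ (by fun_prop), sq, mul_assoc]
  have down : ENNReal.ofReal lam ^ 2 * ∫⁻ z in P.support, ∫⁻ z' in P.support,
      localSqDiff P.support r u (z, z')
      ≤ ∫⁻ z, ∫⁻ z', localSqDiff P.support r u (z, z') ∂P ∂P := by
    refine le_trans (le_of_eq ?_) (lintegral_mono' h.smul_volume_le fun x =>
      lintegral_mono' h.smul_volume_le le_rfl)
    simp only [lintegral_smul_measure, smul_eq_mul]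
    rw [lintegral_const_mul _ (by fun_prop), sq, mul_assoc]
  calc _ ≤ ENNReal.ofReal lam ^ 2 * (ENNReal.ofReal Lam ^ 2 * ((N : ℝ≥0∞) ^ (d + 2) *
          ∫⁻ z in P.support, ∫⁻ z' in P.support, localSqDiff P.support r u (z, z'))) := by
        gcongr
        exact up.trans (by gcongr; exact lintegral_sq_sub_le_localSqDiff hS hconv hu hN hr)
    _ = ENNReal.ofReal Lam ^ 2 * (N : ℝ≥0∞) ^ (d + 2) * (ENNReal.ofReal lam ^ 2 *
          ∫⁻ z in P.support, ∫⁻ z' in P.support, localSqDiff P.support r u (z, z')) := by ring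
    _ ≤ _ := by gcongr


/-! ### The energy on the superlevel set of a potential -/

theorem ofReal_mul_le_lintegral_of_forall_le {X : Type*} [MeasurableSpace X] {μ : Measure X}
    [IsFiniteMeasure μ] {B : Set X} (hB : MeasurableSet B) {q : ℝ} (hq : q ≤ μ.real B)
    {a : ℝ≥0∞} {φ : X → ℝ≥0∞} (h : ∀ y ∈ B, a ≤ φ y) :
    ENNReal.ofReal q * a ≤ ∫⁻ y, φ y ∂μ := by
  calc ENNReal.ofReal q * a ≤ μ B * a := by
        gcongr
        exact ENNReal.ofReal_le_of_le_toReal hq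
    _ = ∫⁻ _ in B, a ∂μ := by rw [setLIntegral_const, mul_comm]
    _ ≤ ∫⁻ y in B, φ y ∂μ := setLIntegral_mono' hB h
    _ ≤ _ := setLIntegral_le_lintegral _ _

theorem ofReal_sq_add_le (a b : ℝ) :
    ENNReal.ofReal ((a + b) ^ 2)
      ≤ 2 * (ENNReal.ofReal (a ^ 2) + ENNReal.ofReal (b ^ 2)) := by
  have h2 : (2 : ℝ≥0∞) = ENNReal.ofReal 2 := by simp
  rw [← ENNReal.ofReal_add (sq_nonneg _) (sq_nonneg _), h2, ← ENNReal.ofReal_mul zero_le_two]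
  exact ENNReal.ofReal_le_ofReal add_sq_le

/-- The function `(u ⊕ v)²` restricted to the superlevel set `{ξ ≥ s}`. -/
def levelEnergy {d : ℕ} (ξ : Pt d → Pt d → ℝ) (s : ℝ) (u v : Pt d → ℝ) : Pt d × Pt d → ℝ≥0∞ :=
  indicator {z | s ≤ ξ z.1 z.2} fun z => ENNReal.ofReal ((u z.1 + v z.2) ^ 2)

theorem levelEnergy_of_le {d : ℕ} {ξ : Pt d → Pt d → ℝ} {s : ℝ} {u v : Pt d → ℝ} {x y : Pt d}
    (h : s ≤ ξ x y) : levelEnergy ξ s u v (x, y) = ENNReal.ofReal ((u x + v y) ^ 2) :=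
  indicator_of_mem (s := {z : Pt d × Pt d | s ≤ ξ z.1 z.2}) h _

theorem measurable_levelEnergy {d : ℕ} {ξ : Pt d → Pt d → ℝ}
    (hξ : Measurable fun z : Pt d × Pt d => ξ z.1 z.2) (s : ℝ) {u v : Pt d → ℝ}
    (hu : Measurable u) (hv : Measurable v) : Measurable (levelEnergy ξ s u v) := by
  have h : Measurable fun z : Pt d × Pt d => ENNReal.ofReal ((u z.1 + v z.2) ^ 2) := by fun_prop
  exact h.indicator (measurableSet_le measurable_const hξ)

/-- Two points `z, z'` with common partners `y` in a ball of mass at least `q`: the increment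
`u z - u z' = (u z + v y) - (u z' + v y)` is controlled by averaging over these `y`. -/
theorem ofReal_mul_sq_sub_le {d : ℕ} {Q : Measure (Pt d)} [IsFiniteMeasure Q]
    {ξ : Pt d → Pt d → ℝ} {s q r : ℝ} {u v : Pt d → ℝ} (hu : Measurable u) (hv : Measurable v)
    (hξ : Measurable fun z : Pt d × Pt d => ξ z.1 z.2) {z z' y₀ : Pt d}
    (hq : q ≤ Q.real (Metric.ball y₀ r))
    (hz : ∀ y ∈ Metric.ball y₀ r, s ≤ ξ z y ∧ s ≤ ξ z' y) :
    ENNReal.ofReal q * ENNReal.ofReal ((u z - u z') ^ 2)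
      ≤ 2 * (∫⁻ y, levelEnergy ξ s u v (z, y) ∂Q + ∫⁻ y, levelEnergy ξ s u v (z', y) ∂Q) := by
  have hk := measurable_levelEnergy hξ s hu hv
  rw [← lintegral_add_left (by fun_prop), ← lintegral_const_mul _ (by fun_prop)]
  refine ofReal_mul_le_lintegral_of_forall_le Metric.isOpen_ball.measurableSet hq fun y hy => ?_
  rw [levelEnergy_of_le (hz y hy).1, levelEnergy_of_le (hz y hy).2]
  have h := ofReal_sq_add_le (u z + v y) (-(u z' + v y))
  rwa [neg_sq, show u z + v y + -(u z' + v y) = u z - u z' by ring] at h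

theorem lintegral_sq_sub_eq_variance {X : Type*} [MeasurableSpace X] {μ : Measure X}
    [IsProbabilityMeasure μ] {u : X → ℝ} (hu : MemLp u 2 μ) :
    ∫⁻ x, ∫⁻ x', ENNReal.ofReal ((u x - u x') ^ 2) ∂μ ∂μ
      = ENNReal.ofReal (2 * ∫ x, (u x - ∫ t, u t ∂μ) ^ 2 ∂μ) := by
  set m := ∫ t, u t ∂μ with hm
  set V := ∫ x, (u x - m) ^ 2 ∂μ with hV
  have hw : MemLp (fun x => u x - m) 2 μ := hu.sub (memLp_const m)
  have hwi : Integrable (fun x => u x - m) μ := hw.integrable one_le_two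
  have hw2 : Integrable (fun x => (u x - m) ^ 2) μ := hw.integrable_sq
  have hV0 : 0 ≤ V := integral_nonneg fun x => sq_nonneg _
  have hw0 : ∫ x, (u x - m) ∂μ = 0 := by
    rw [integral_sub (hu.integrable one_le_two) (integrable_const m)]
    simp [hm]
  have inner : ∀ x, ∫⁻ x', ENNReal.ofReal ((u x - u x') ^ 2) ∂μ
      = ENNReal.ofReal ((u x - m) ^ 2 + V) := by
    intro x
    have e : ∀ x', (u x - u x') ^ 2
        = (u x - m) ^ 2 - 2 * (u x - m) * (u x' - m) + (u x' - m) ^ 2 := fun x' => by ring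
    have hl : Integrable (fun x' => (u x - m) ^ 2 - 2 * (u x - m) * (u x' - m)) μ :=
      (integrable_const _).sub (hwi.const_mul _)
    have hi : Integrable (fun x' => (u x - u x') ^ 2) μ := by
      simp only [e]
      exact hl.add hw2
    rw [← ofReal_integral_eq_lintegral_ofReal hi (ae_of_all _ fun _ => sq_nonneg _)]
    congr 1
    simp only [e]
    rw [integral_add hl hw2, integral_sub (integrable_const _) (hwi.const_mul _),
      integral_const_mul, hw0]
    simp [hV]
  simp only [inner]
  have hs : Integrable (fun x => (u x - m) ^ 2 + V) μ := hw2.add (integrable_const V)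
  rw [← ofReal_integral_eq_lintegral_ofReal hs
    (ae_of_all _ fun x => by positivity)]
  congr 1
  rw [integral_add hw2 (integrable_const V)]
  simp [← hV]; ring

/-- The decomposition of the `L²`-norm of `u ⊕ v` after subtracting the mean of `u`. -/
theorem integral_sq_oplus_eq {X Y : Type*} [MeasurableSpace X] [MeasurableSpace Y] {μ : Measure X}
    {ν : Measure Y} [IsProbabilityMeasure μ] [IsProbabilityMeasure ν] {u : X → ℝ} {v : Y → ℝ}
    (hu : MemLp u 2 μ) (hv : MemLp v 2 ν) :
    ∫ z, (u z.1 + v z.2) ^ 2 ∂(μ.prod ν)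
      = ∫ x, (u x - ∫ t, u t ∂μ) ^ 2 ∂μ + ∫ y, (v y + ∫ t, u t ∂μ) ^ 2 ∂ν := by
  set m := ∫ t, u t ∂μ with hm
  have hw : MemLp (fun x => u x - m) 2 μ := hu.sub (memLp_const m)
  have hv' : MemLp (fun y => v y + m) 2 ν := hv.add (memLp_const m)
  have hw0 : ∫ x, (u x - m) ∂μ = 0 := by
    rw [integral_sub (hu.integrable one_le_two) (integrable_const m)]
    simp [hm]
  have e : ∀ z : X × Y, (u z.1 + v z.2) ^ 2
      = (u z.1 - m) ^ 2 + 2 * ((u z.1 - m) * (v z.2 + m)) + (v z.2 + m) ^ 2 := fun z => by ring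
  have i1 : Integrable (fun z : X × Y => (u z.1 - m) ^ 2) (μ.prod ν) :=
    hw.integrable_sq.comp_fst ν
  have i2 : Integrable (fun z : X × Y => 2 * ((u z.1 - m) * (v z.2 + m))) (μ.prod ν) :=
    ((hw.integrable one_le_two).mul_prod (hv'.integrable one_le_two)).const_mul 2
  have i3 : Integrable (fun z : X × Y => (v z.2 + m) ^ 2) (μ.prod ν) :=
    hv'.integrable_sq.comp_snd μ
  have i12 : Integrable (fun z : X × Y => (u z.1 - m) ^ 2 + 2 * ((u z.1 - m) * (v z.2 + m)))
      (μ.prod ν) := i1.add i2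
  simp only [e]
  rw [integral_add i12 i3, integral_add i1 i2, integral_const_mul,
    integral_prod_mul (fun x => u x - m) (fun y => v y + m), hw0,
    integral_fun_fst (fun x => (u x - m) ^ 2), integral_fun_snd (fun y => (v y + m) ^ 2)]
  simp

/-- Suppose that `ξ` is `2 L`-Lipschitz in each variable and that almost every point of either
space has a partner in the other with `ξ ≥ ε`. Then the `L²`-norm of `u ⊕ v` is controlled by its
restriction to `{ξ ≥ ε / 2}`: by the Lipschitz bound, partners persist on balls of radius
`ε / (8 L)`, so that short increments of `u` are controlled by averaging over partners, the
variance of `u` by the nonlocal Poincaré inequality, and `v` by averaging over partners again. -/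
theorem integral_sq_oplus_le_level {d : ℕ} {P Q : Measure (Pt d)} [IsProbabilityMeasure P]
    [IsProbabilityMeasure Q] {ρ : Pt d → ℝ} {lam Lam δ L ε : ℝ} (hd : 1 ≤ d)
    (hP : IsCompact P.support) (hconv : Convex ℝ P.support) (hQ : IsCompact Q.support)
    (hlam : 0 < lam) (hρ : HasDensityBounds P ρ lam Lam) (hδ : IsBallMassConstant P δ)
    (hL : 0 < L) (hε : 0 < ε) {ξ : Pt d → Pt d → ℝ}
    (hξm : Measurable fun z : Pt d × Pt d => ξ z.1 z.2)
    (hξ : ∀ x x' y y', |ξ x y - ξ x' y'| ≤ 2 * L * (‖x - x'‖ + ‖y - y'‖))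
    (hx : ∀ᵐ x ∂P, ∃ y ∈ Q.support, ε ≤ ξ x y) (hy : ∀ᵐ y ∂Q, ∃ x ∈ P.support, ε ≤ ξ x y)
    {u v : Pt d → ℝ} (hum : Measurable u) (hvm : Measurable v) (hu : MemLp u 2 P)
    (hv : MemLp v 2 Q) :
    ∫ z, (u z.1 + v z.2) ^ 2 ∂(P.prod Q) ≤ gammaConst P Q δ lam Lam L ε / 2 *
      ∫ z in {z | ε / 2 ≤ ξ z.1 z.2}, (u z.1 + v z.2) ^ 2 ∂(P.prod Q) := by
  set r : ℝ := ε / (8 * L) with hr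
  have hr0 : 0 < r := by positivity
  set q : ℝ := ⨅ y : Q.support, Q.real (Metric.ball (y : Pt d) r) with hqdef
  have hq0 : 0 < q := iInf_measureReal_ball_pos hQ hr0
  have hq : ∀ y ∈ Q.support, q ≤ Q.real (Metric.ball y r) := fun y hy => iInf_measureReal_ball_le hy
  set N : ℕ := ⌈8 * L * Metric.diam P.support / ε⌉₊ with hNdef
  have hdiam := hρ.diam_pos hd hP
  have hN : 0 < N := Nat.ceil_pos.2 (by positivity)
  have hNr : Metric.diam P.support ≤ N * r := by
    have h := Nat.le_ceil (8 * L * Metric.diam P.support / ε)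
    rw [← hNdef] at h
    calc Metric.diam P.support = 8 * L * Metric.diam P.support / ε * r := by
          rw [hr]; field_simp
      _ ≤ N * r := by gcongr
  set m : ℝ := δ * min (r ^ d) 1 with hmdef
  have hm0 : 0 < m := mul_pos hδ.pos (lt_min (by positivity) one_pos)
  have hm : ∀ x ∈ P.support, m ≤ P.real (Metric.ball x r) := fun x hx => hδ.le_ball x hx r hr0
  have hm1 : m ≤ 1 := mul_le_one₀ hδ.le_one (by positivity) (min_le_right _ _)
  obtain ⟨x₀, hx₀⟩ := Measure.nonempty_support (IsProbabilityMeasure.ne_zero P)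
  obtain ⟨y₀, hy₀⟩ := Measure.nonempty_support (IsProbabilityMeasure.ne_zero Q)
  have hLam : lam ≤ Lam := (hρ.bounds x₀ hx₀).1.trans (hρ.bounds x₀ hx₀).2
  have hLam0 : 0 < Lam := hlam.trans_le hLam
  have hq1 : q ≤ 1 := (hq y₀ hy₀).trans measureReal_le_one
  -- moving both points of a pair with `ξ ≥ ε` by at most `r` changes `ξ` by at most `ε / 2`
  have hstay : ∀ x x' y y', ε ≤ ξ x y → dist x x' ≤ r → dist y y' ≤ r → ε / 2 ≤ ξ x' y' := by
    intro x x' y y' h h1 h2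
    have h3 := (abs_le.1 (hξ x x' y y')).2
    rw [dist_eq_norm] at h1 h2
    have h4 : 2 * L * (‖x - x'‖ + ‖y - y'‖) ≤ 2 * L * (r + r) := by gcongr
    have h5 : 2 * L * (r + r) = ε / 2 := by rw [hr]; field_simp; ring
    linarith
  set k := levelEnergy ξ (ε / 2) u v with hk
  have hkm : Measurable k := measurable_levelEnergy hξm _ hum hvm
  set J : ℝ := ∫ z in {z | ε / 2 ≤ ξ z.1 z.2}, (u z.1 + v z.2) ^ 2 ∂(P.prod Q) with hJ
  have hJ0 : 0 ≤ J := integral_nonneg fun z => sq_nonneg _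
  have hint : Integrable (fun z : Pt d × Pt d => (u z.1 + v z.2) ^ 2) (P.prod Q) :=
    ((hu.comp_fst Q).add (hv.comp_snd P)).integrable_sq
  have hset : MeasurableSet {z : Pt d × Pt d | ε / 2 ≤ ξ z.1 z.2} :=
    measurableSet_le measurable_const hξm
  have hJe : ∫⁻ x, ∫⁻ y, k (x, y) ∂Q ∂P = ENNReal.ofReal J := by
    rw [← lintegral_prod _ hkm.aemeasurable, hk, levelEnergy, lintegral_indicator hset, hJ,
      ofReal_integral_eq_lintegral_ofReal hint.integrableOn (ae_of_all _ fun _ => sq_nonneg _)]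
  set V : ℝ := ∫ x, (u x - ∫ t, u t ∂P) ^ 2 ∂P with hV
  have hV0 : 0 ≤ V := integral_nonneg fun z => sq_nonneg _
  set W : ℝ := ∫ y, (v y + ∫ t, u t ∂P) ^ 2 ∂Q with hW
  -- almost every `z` has a ball of partners, common to all `z'` within distance `r`
  have hloc : ENNReal.ofReal q *
      ∫⁻ z, ∫⁻ z', localSqDiff P.support r u (z, z') ∂P ∂P ≤ ENNReal.ofReal (4 * J) := by
    have hlm := measurable_localSqDiff (Measure.isClosed_support (μ := P)).measurableSet r hum
    have h1 : ∀ᵐ z ∂P, ∀ z', ENNReal.ofReal q * localSqDiff P.support r u (z, z')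
        ≤ 2 * (∫⁻ y, k (z, y) ∂Q + ∫⁻ y, k (z', y) ∂Q) := by
      filter_upwards [hx] with z ⟨y, hyQ, hzy⟩ z'
      by_cases h : z ∈ P.support ∧ z' ∈ P.support ∧ dist z z' ≤ r
      · rw [localSqDiff, indicator_of_mem (by exact h)]
        refine ofReal_mul_sq_sub_le hum hvm hξm (hq y hyQ) fun y' hy' => ?_
        have hyy : dist y y' ≤ r := by rw [dist_comm]; exact (Metric.mem_ball.1 hy').le
        exact ⟨hstay z z y y' hzy (by simpa using hr0.le) hyy, hstay z z' y y' hzy h.2.2 hyy⟩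
      · rw [localSqDiff, indicator_of_notMem (by exact h), mul_zero]
        exact zero_le
    rw [← lintegral_const_mul _ (by fun_prop)]
    calc ∫⁻ z, ENNReal.ofReal q * ∫⁻ z', localSqDiff P.support r u (z, z') ∂P ∂P
        ≤ ∫⁻ z, ∫⁻ z', 2 * (∫⁻ y, k (z, y) ∂Q + ∫⁻ y, k (z', y) ∂Q) ∂P ∂P := by
          refine lintegral_mono_ae ?_
          filter_upwards [h1] with z hz
          rw [← lintegral_const_mul _ (by fun_prop)]
          exact lintegral_mono hz
      _ = 2 * (ENNReal.ofReal J + ENNReal.ofReal J) := by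
          have e : ∀ z, ∫⁻ z', 2 * (∫⁻ y, k (z, y) ∂Q + ∫⁻ y, k (z', y) ∂Q) ∂P
              = 2 * (∫⁻ y, k (z, y) ∂Q + ENNReal.ofReal J) := by
            intro z
            rw [lintegral_const_mul _ (by fun_prop), lintegral_add_left (by fun_prop), hJe]
            simp
          simp only [e]
          rw [lintegral_const_mul _ (by fun_prop), lintegral_add_left (by fun_prop), hJe]
          simp
      _ = ENNReal.ofReal (4 * J) := by
          rw [← ENNReal.ofReal_add hJ0 hJ0, show (2 : ℝ≥0∞) = ENNReal.ofReal 2 by simp,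
            ← ENNReal.ofReal_mul zero_le_two]
          congr 1; ring
  have hvar : q * lam ^ 2 * (2 * V) ≤ Lam ^ 2 * (N : ℝ) ^ (d + 2) * (4 * J) := by
    have h1 := hρ.lintegral_sq_sub_le (r := r) hconv hum hN fun x hx x' hx' =>
      (Metric.dist_le_diam_of_mem hP.isBounded hx hx').trans hNr
    rw [lintegral_sq_sub_eq_variance hu] at h1
    have h2 : ENNReal.ofReal q * (ENNReal.ofReal lam ^ 2 * ENNReal.ofReal (2 * V))
        ≤ ENNReal.ofReal Lam ^ 2 * (N : ℝ≥0∞) ^ (d + 2) * ENNReal.ofReal (4 * J) := by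
      calc _ ≤ ENNReal.ofReal q * (ENNReal.ofReal Lam ^ 2 * (N : ℝ≥0∞) ^ (d + 2) *
            ∫⁻ z, ∫⁻ z', localSqDiff P.support r u (z, z') ∂P ∂P) := by gcongr
        _ = ENNReal.ofReal Lam ^ 2 * (N : ℝ≥0∞) ^ (d + 2) * (ENNReal.ofReal q *
            ∫⁻ z, ∫⁻ z', localSqDiff P.support r u (z, z') ∂P ∂P) := by ring
        _ ≤ _ := by gcongr
    rw [← ENNReal.ofReal_natCast, ← ENNReal.ofReal_pow hlam.le, ← ENNReal.ofReal_pow hLam0.le,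
      ← ENNReal.ofReal_pow (by positivity), ← ENNReal.ofReal_mul (by positivity),
      ← ENNReal.ofReal_mul (by positivity), ← ENNReal.ofReal_mul (by positivity),
      ← ENNReal.ofReal_mul (by positivity), ENNReal.ofReal_le_ofReal_iff (by positivity)] at h2
    linarith
  -- `v + ū = (u ⊕ v) - (u - ū)` is averaged over the partners of a point, `ū` the mean of `u`
  have hWle : m * W ≤ 2 * (J + V) := by
    set a := ∫ t, u t ∂P with ha
    have h1 : ∀ᵐ y ∂Q, ENNReal.ofReal m * ENNReal.ofReal ((v y + a) ^ 2)
        ≤ 2 * (∫⁻ x, k (x, y) ∂P + ENNReal.ofReal V) := by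
      filter_upwards [hy] with y ⟨x, hxP, hxy⟩
      have hVe : ENNReal.ofReal V = ∫⁻ t, ENNReal.ofReal ((u t - a) ^ 2) ∂P :=
        ofReal_integral_eq_lintegral_ofReal (hu.sub (memLp_const a)).integrable_sq
          (ae_of_all _ fun _ => sq_nonneg _)
      rw [hVe, ← lintegral_add_left (by fun_prop), ← lintegral_const_mul _ (by fun_prop)]
      refine ofReal_mul_le_lintegral_of_forall_le Metric.isOpen_ball.measurableSet (hm x hxP)
        fun t ht => ?_
      have ht' : dist x t ≤ r := by rw [dist_comm]; exact (Metric.mem_ball.1 ht).le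
      rw [hk, levelEnergy_of_le (hstay x t y y hxy ht' (by simpa using hr0.le))]
      have h := ofReal_sq_add_le (u t + v y) (-(u t - a))
      rwa [neg_sq, show u t + v y + -(u t - a) = v y + a by ring] at h
    have hWe : ENNReal.ofReal W = ∫⁻ y, ENNReal.ofReal ((v y + a) ^ 2) ∂Q :=
      ofReal_integral_eq_lintegral_ofReal (hv.add (memLp_const a)).integrable_sq
        (ae_of_all _ fun _ => sq_nonneg _)
    have h2 : ENNReal.ofReal m * ENNReal.ofReal W
        ≤ 2 * (ENNReal.ofReal J + ENNReal.ofReal V) := by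
      rw [hWe, ← lintegral_const_mul _ (by fun_prop), ← hJe,
        lintegral_lintegral_swap (by fun_prop)]
      refine (lintegral_mono_ae h1).trans (le_of_eq ?_)
      rw [lintegral_const_mul _ (by fun_prop), lintegral_add_left (by fun_prop)]
      simp
    rw [← ENNReal.ofReal_add hJ0 hV0, show (2 : ℝ≥0∞) = ENNReal.ofReal 2 by simp,
      ← ENNReal.ofReal_mul zero_le_two, ← ENNReal.ofReal_mul hm0.le,
      ENNReal.ofReal_le_ofReal_iff (by positivity)] at h2
    exact h2
  rw [integral_sq_oplus_eq hu hv, ← hV, ← hW]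
  -- bookkeeping of the constants
  set K : ℝ := Lam ^ 2 / lam ^ 2 * ((N : ℝ) ^ (d + 2) / q) with hK
  have hminv : δ⁻¹ * (max (8 * L / ε) 1) ^ d = m⁻¹ := by
    have h8 : 8 * L / ε = r⁻¹ := by rw [hr, inv_div]
    rw [hmdef, mul_inv, h8]
    congr 1
    rcases le_total r 1 with h | h
    · rw [max_eq_left ((one_le_inv₀ hr0).2 h), min_eq_left (pow_le_one₀ hr0.le h), inv_pow]
    · rw [max_eq_right (inv_le_one_of_one_le₀ h), min_eq_right (one_le_pow₀ h)]; simp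
  have hγ : gammaConst P Q δ lam Lam L ε / 2 = 8 * m⁻¹ * K := by
    rw [gammaConst, hminv, ← hr, ← hqdef, ← hNdef, hK]; ring
  have hK1 : 1 ≤ K := by
    have h1 : 1 ≤ Lam ^ 2 / lam ^ 2 := (one_le_div (by positivity)).2 (by gcongr)
    have h2 : 1 ≤ (N : ℝ) ^ (d + 2) / q := (one_le_div hq0).2
      (hq1.trans (one_le_pow₀ (by exact_mod_cast hN)))
    exact one_le_mul_of_one_le_of_one_le h1 h2
  have hVK : V ≤ 2 * K * J := by
    have h1 : 2 * K * J = Lam ^ 2 * (N : ℝ) ^ (d + 2) * (4 * J) / (2 * (q * lam ^ 2)) := by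
      rw [hK]; field_simp; ring
    rw [h1, le_div_iff₀ (by positivity)]
    linarith
  have hWm : W ≤ m⁻¹ * (2 * (J + V)) := by
    rw [inv_mul_eq_div, le_div_iff₀ hm0]; linarith
  have hm1' : 1 ≤ m⁻¹ := (one_le_inv₀ hm0).2 hm1
  have hKJ : J ≤ K * J := le_mul_of_one_le_left hJ0 hK1
  rw [hγ]
  calc V + W ≤ m⁻¹ * (2 * K * J) + m⁻¹ * (2 * (K * J + 2 * K * J)) := by
        refine add_le_add (hVK.trans (le_mul_of_one_le_left (by positivity) hm1')) (hWm.trans ?_)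
        gcongr
    _ = 8 * m⁻¹ * K * J := by ring


/-! ### Differentiability of the dual objective -/

theorem add_two_mul_le_sq_max_add (a s : ℝ) :
    (max a 0) ^ 2 + 2 * max a 0 * s ≤ (max (a + s) 0) ^ 2 := by
  have h1 : a + s ≤ max (a + s) 0 := le_max_left _ _
  have h2 : 0 ≤ max (a + s) 0 := le_max_right _ _
  rcases le_total a 0 with h | h
  · rw [max_eq_right h]; nlinarith
  · rw [max_eq_left h]; nlinarith [sq_nonneg (max (a + s) 0 - a)]

theorem sq_max_add_le (a s : ℝ) :
    (max (a + s) 0) ^ 2 ≤ (max a 0) ^ 2 + 2 * max a 0 * s + s ^ 2 := by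
  have h1 : a ≤ max a 0 := le_max_left _ _
  have h2 : (max a 0 + s) ^ 2 = (max a 0) ^ 2 + 2 * max a 0 * s + s ^ 2 := by ring
  rw [← h2]
  rcases le_total (a + s) 0 with h | h
  · rw [max_eq_right h, zero_pow two_ne_zero]; positivity
  · rw [max_eq_left h]; gcongr

/-- The positive part is strongly monotone at points `a ≥ ε / 2`, for increments up to `M`. -/
theorem div_mul_sq_le_max_add_sub_mul {a s ε M : ℝ} (hε : 0 < ε) (ha : ε / 2 ≤ a) (hs : |s| ≤ M) :
    ε / (2 * max M ε) * s ^ 2 ≤ (max (a + s) 0 - max a 0) * s := by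
  have hK : 0 < max M ε := hε.trans_le (le_max_right _ _)
  have hsK : |s| ≤ max M ε := hs.trans (le_max_left _ _)
  have ha0 : 0 ≤ a := by linarith
  rw [max_eq_left ha0]
  rcases le_total (a + s) 0 with h | h
  · rw [max_eq_right h]
    have hs0 : s ≤ 0 := by linarith
    rw [abs_of_nonpos hs0] at hsK
    calc ε / (2 * max M ε) * s ^ 2 = ε / (2 * max M ε) * (-s) * (-s) := by ring
      _ ≤ ε / (2 * max M ε) * max M ε * (-s) := by gcongr; linarith
      _ = ε / 2 * (-s) := by field_simp
      _ ≤ a * (-s) := by gcongr; linarith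
      _ = _ := by ring
  · rw [max_eq_left h]
    have : ε / (2 * max M ε) ≤ 1 :=
      (div_le_one (by positivity)).2 (by linarith [le_max_right M ε])
    nlinarith [sq_nonneg s]

theorem max_add_sub_mul_nonneg (a s : ℝ) : 0 ≤ (max (a + s) 0 - max a 0) * s := by
  rcases le_total 0 s with h | h
  · exact mul_nonneg (sub_nonneg.2 (max_le_max_right _ (by linarith))) h
  · exact mul_nonneg_of_nonpos_of_nonpos
      (sub_nonpos.2 (max_le_max_right _ (by linarith))) h

section Integrand

variable {X : Type*} [MeasurableSpace X] {μ : Measure X} {b F S : X → ℝ}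

theorem memLp_max_sub (hF : MemLp F 2 μ) (hb : MemLp b 2 μ) :
    MemLp (fun z => max (F z - b z) 0) 2 μ :=
  (hF.sub hb).sup (MemLp.zero' (μ := μ) (p := 2) (ε := ℝ))

theorem integrable_dualIntegrand [IsFiniteMeasure μ] (hF : MemLp F 2 μ) (hb : MemLp b 2 μ) (ε : ℝ) :
    Integrable (fun z => F z - 1 / (2 * ε) * (max (F z - b z) 0) ^ 2) μ :=
  (hF.integrable one_le_two).sub ((memLp_max_sub hF hb).integrable_sq.const_mul _)

theorem memLp_slope [IsFiniteMeasure μ] (hF : MemLp F 2 μ) (hb : MemLp b 2 μ) (ε : ℝ) :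
    MemLp (fun z => 1 - ε⁻¹ * max (F z - b z) 0) 2 μ :=
  (memLp_const 1).sub ((memLp_max_sub hF hb).const_mul _)

theorem integral_dualIntegrand_add_le [IsFiniteMeasure μ] (hF : MemLp F 2 μ)
    (hb : MemLp b 2 μ) (hS : MemLp S 2 μ)
    {ε : ℝ} (hε : 0 < ε) :
    ∫ z, (F z + S z - 1 / (2 * ε) * (max (F z + S z - b z) 0) ^ 2) ∂μ
      ≤ ∫ z, (F z - 1 / (2 * ε) * (max (F z - b z) 0) ^ 2) ∂μ
        + ∫ z, (1 - ε⁻¹ * max (F z - b z) 0) * S z ∂μ := by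
  have i1 := integrable_dualIntegrand hF hb ε
  have i2 : Integrable (fun z => (1 - ε⁻¹ * max (F z - b z) 0) * S z) μ :=
    (memLp_slope hF hb ε).integrable_mul hS
  rw [← integral_add i1 i2]
  refine integral_mono (integrable_dualIntegrand (hF.add hS) hb ε) (i1.add i2) fun z => ?_
  have h := add_two_mul_le_sq_max_add (F z - b z) (S z)
  rw [show F z - b z + S z = F z + S z - b z by ring] at h
  have h2 := mul_le_mul_of_nonneg_left h (show 0 ≤ 1 / (2 * ε) by positivity)
  have e : 1 / (2 * ε) * ((max (F z - b z) 0) ^ 2 + 2 * max (F z - b z) 0 * S z)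
      = 1 / (2 * ε) * (max (F z - b z) 0) ^ 2 + ε⁻¹ * max (F z - b z) 0 * S z := by
    field_simp
  linarith

theorem le_integral_dualIntegrand_add [IsFiniteMeasure μ] (hF : MemLp F 2 μ)
    (hb : MemLp b 2 μ) (hS : MemLp S 2 μ)
    {ε : ℝ} (hε : 0 < ε) :
    ∫ z, (F z - 1 / (2 * ε) * (max (F z - b z) 0) ^ 2) ∂μ
        + ∫ z, (1 - ε⁻¹ * max (F z - b z) 0) * S z ∂μ - 1 / (2 * ε) * ∫ z, S z ^ 2 ∂μ
      ≤ ∫ z, (F z + S z - 1 / (2 * ε) * (max (F z + S z - b z) 0) ^ 2) ∂μ := by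
  have i1 := integrable_dualIntegrand hF hb ε
  have i2 : Integrable (fun z => (1 - ε⁻¹ * max (F z - b z) 0) * S z) μ :=
    (memLp_slope hF hb ε).integrable_mul hS
  have i3 : Integrable (fun z => 1 / (2 * ε) * S z ^ 2) μ := hS.integrable_sq.const_mul _
  have i12 : Integrable (fun z => F z - 1 / (2 * ε) * (max (F z - b z) 0) ^ 2
      + (1 - ε⁻¹ * max (F z - b z) 0) * S z) μ := i1.add i2
  rw [← integral_add i1 i2, ← integral_const_mul, ← integral_sub i12 i3]
  refine integral_mono (i12.sub i3)
    (integrable_dualIntegrand (hF.add hS) hb ε) fun z => ?_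
  have h := sq_max_add_le (F z - b z) (S z)
  rw [show F z - b z + S z = F z + S z - b z by ring] at h
  have h2 := mul_le_mul_of_nonneg_left h (show 0 ≤ 1 / (2 * ε) by positivity)
  have e : 1 / (2 * ε) * ((max (F z - b z) 0) ^ 2 + 2 * max (F z - b z) 0 * S z + S z ^ 2)
      = 1 / (2 * ε) * (max (F z - b z) 0) ^ 2 + ε⁻¹ * max (F z - b z) 0 * S z
        + 1 / (2 * ε) * S z ^ 2 := by
    field_simp
  linarith

theorem L2_norm_sq_eq_integral (f : Lp ℝ 2 μ) : ‖f‖ ^ 2 = ∫ z, f z ^ 2 ∂μ := by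
  rw [← real_inner_self_eq_norm_sq, L2.inner_def]
  simp [sq]

theorem eLpNorm_two_toReal_sq (hF : MemLp F 2 μ) :
    (eLpNorm F 2 μ).toReal ^ 2 = ∫ z, F z ^ 2 ∂μ := by
  rw [← Lp.norm_toLp F hF, L2_norm_sq_eq_integral]
  refine integral_congr_ae ?_
  filter_upwards [hF.coeFn_toLp] with z hz
  rw [hz]

end Integrand

section Dual

variable {d : ℕ} {P Q : Measure (Pt d)} [IsProbabilityMeasure P] [IsProbabilityMeasure Q]
  {c : Pt d → Pt d → ℝ} {ε : ℝ}

/-- The operator `(f, g) ↦ f ⊕ g` from `L²(P) × L²(Q)` to `L²(P ⊗ Q)`. -/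
def oplusL (P Q : Measure (Pt d)) [IsProbabilityMeasure P] [IsProbabilityMeasure Q] :
    DualSpace P Q →L[ℝ] Lp ℝ 2 (P.prod Q) :=
  (Lp.compMeasurePreservingₗᵢ ℝ Prod.fst
        (measurePreserving_fst (μ := P) (ν := Q))).toContinuousLinearMap
      ∘L WithLp.fstL 2 ℝ (Lp ℝ 2 P) (Lp ℝ 2 Q)
    + (Lp.compMeasurePreservingₗᵢ ℝ Prod.snd
        (measurePreserving_snd (μ := P) (ν := Q))).toContinuousLinearMap
      ∘L WithLp.sndL 2 ℝ (Lp ℝ 2 P) (Lp ℝ 2 Q)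

theorem coeFn_oplusL (p : DualSpace P Q) : oplusL P Q p =ᵐ[P.prod Q] oplus p := by
  have h1 := Lp.coeFn_compMeasurePreserving p.fst (measurePreserving_fst (μ := P) (ν := Q))
  have h2 := Lp.coeFn_compMeasurePreserving p.snd (measurePreserving_snd (μ := P) (ν := Q))
  have h3 := Lp.coeFn_add
    (Lp.compMeasurePreserving Prod.fst (measurePreserving_fst (μ := P) (ν := Q)) p.fst)
    (Lp.compMeasurePreserving Prod.snd (measurePreserving_snd (μ := P) (ν := Q)) p.snd)
  refine h3.trans ?_
  filter_upwards [h1, h2] with z e1 e2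
  exact congrArg₂ (· + ·) e1 e2

theorem memLp_oplus (p : DualSpace P Q) : MemLp (oplus p) 2 (P.prod Q) :=
  ((Lp.memLp p.fst).comp_fst Q).add ((Lp.memLp p.snd).comp_snd P)

theorem oplus_add (p q : DualSpace P Q) :
    oplus (p + q) =ᵐ[P.prod Q] fun z => oplus p z + oplus q z := by
  have h := Lp.coeFn_add (oplusL P Q p) (oplusL P Q q)
  rw [← map_add] at h
  filter_upwards [h, coeFn_oplusL p, coeFn_oplusL q, coeFn_oplusL (p + q)] with z h1 h2 h3 h4
  rw [← h4, h1, Pi.add_apply, h2, h3]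

theorem oplus_sub (p q : DualSpace P Q) :
    oplus (p - q) =ᵐ[P.prod Q] fun z => oplus p z - oplus q z := by
  have h := Lp.coeFn_sub (oplusL P Q p) (oplusL P Q q)
  rw [← map_sub] at h
  filter_upwards [h, coeFn_oplusL p, coeFn_oplusL q, coeFn_oplusL (p - q)] with z h1 h2 h3 h4
  rw [← h4, h1, Pi.sub_apply, h2, h3]

theorem integral_sq_oplus_le (q : DualSpace P Q) :
    ∫ z, oplus q z ^ 2 ∂(P.prod Q) ≤ ‖oplusL P Q‖ ^ 2 * ‖q‖ ^ 2 := by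
  have h : ∫ z, oplus q z ^ 2 ∂(P.prod Q) = ‖oplusL P Q q‖ ^ 2 := by
    rw [L2_norm_sq_eq_integral]
    refine integral_congr_ae ?_
    filter_upwards [coeFn_oplusL q] with z hz
    rw [hz]
  rw [h, ← mul_pow]
  gcongr
  exact (oplusL P Q).le_opNorm q

/-- The derivative of the dual objective at `p`, that is
`q ↦ ∫ (1 - (f ⊕ g - c)₊ / ε) (q₁ ⊕ q₂) d(P ⊗ Q)` for `p = (f, g)`. -/
def dualDeriv (hc : MemLp (fun z : Pt d × Pt d => c z.1 z.2) 2 (P.prod Q)) (ε : ℝ)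
    (p : DualSpace P Q) : DualSpace P Q →L[ℝ] ℝ :=
  innerSL ℝ ((memLp_slope (memLp_oplus p) hc ε).toLp _) ∘L oplusL P Q

theorem dualDeriv_apply (hc : MemLp (fun z : Pt d × Pt d => c z.1 z.2) 2 (P.prod Q)) (ε : ℝ)
    (p q : DualSpace P Q) : dualDeriv hc ε p q
      = ∫ z, (1 - ε⁻¹ * max (oplus p z - c z.1 z.2) 0) * oplus q z ∂(P.prod Q) := by
  rw [dualDeriv, ContinuousLinearMap.comp_apply, innerSL_apply_apply, L2.inner_def]
  refine integral_congr_ae ?_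
  filter_upwards [(memLp_slope (memLp_oplus p) hc ε).coeFn_toLp, coeFn_oplusL q] with z h1 h2
  rw [h1, h2]
  simp [mul_comm]

theorem Gam_add_eq (p q : DualSpace P Q) : Gam P Q c ε (p + q)
    = ∫ z, (oplus p z + oplus q z
        - 1 / (2 * ε) * (max (oplus p z + oplus q z - c z.1 z.2) 0) ^ 2) ∂(P.prod Q) := by
  refine integral_congr_ae ?_
  filter_upwards [oplus_add p q] with z hz
  rw [hz]

/-- The dual objective lies below its tangents. -/
theorem Gam_add_le (hc : MemLp (fun z : Pt d × Pt d => c z.1 z.2) 2 (P.prod Q)) (hε : 0 < ε)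
    (p q : DualSpace P Q) :
    Gam P Q c ε (p + q) ≤ Gam P Q c ε p + dualDeriv hc ε p q := by
  rw [Gam_add_eq, dualDeriv_apply]
  exact integral_dualIntegrand_add_le (memLp_oplus p) hc (memLp_oplus q) hε

theorem le_Gam_add (hc : MemLp (fun z : Pt d × Pt d => c z.1 z.2) 2 (P.prod Q)) (hε : 0 < ε)
    (p q : DualSpace P Q) :
    Gam P Q c ε p + dualDeriv hc ε p q - 1 / (2 * ε) * (‖oplusL P Q‖ ^ 2 * ‖q‖ ^ 2)
      ≤ Gam P Q c ε (p + q) := by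
  rw [Gam_add_eq, dualDeriv_apply]
  refine le_trans ?_ (le_integral_dualIntegrand_add (memLp_oplus p) hc (memLp_oplus q) hε)
  exact sub_le_sub_left
    (mul_le_mul_of_nonneg_left (integral_sq_oplus_le q) (by positivity)) _

theorem hasFDerivAt_Gam (hc : MemLp (fun z : Pt d × Pt d => c z.1 z.2) 2 (P.prod Q)) (hε : 0 < ε)
    (p : DualSpace P Q) : HasFDerivAt (Gam P Q c ε) (dualDeriv hc ε p) p := by
  rw [hasFDerivAt_iff_isLittleO_nhds_zero]
  refine Asymptotics.IsBigO.trans_isLittleO (g := fun q : DualSpace P Q => ‖q‖ ^ 2) ?_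
    (Asymptotics.isLittleO_norm_pow_id one_lt_two)
  refine Asymptotics.IsBigO.of_bound (1 / (2 * ε) * ‖oplusL P Q‖ ^ 2) (.of_forall fun q => ?_)
  have h1 := Gam_add_le hc hε p q
  have h2 := le_Gam_add hc hε p q
  rw [Real.norm_eq_abs, norm_pow, norm_norm, abs_le]
  constructor
  · linarith
  · have : 0 ≤ 1 / (2 * ε) * ‖oplusL P Q‖ ^ 2 * ‖q‖ ^ 2 := by positivity
    linarith

theorem abs_dualDeriv_apply_le (hc : MemLp (fun z : Pt d × Pt d => c z.1 z.2) 2 (P.prod Q))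
    (hε : 0 < ε) (p q : DualSpace P Q) :
    |dualDeriv hc ε p q| ≤ ‖gradient (Gam P Q c ε) p‖ * ‖q‖ := by
  have h : ‖gradient (Gam P Q c ε) p‖ = ‖dualDeriv hc ε p‖ := by
    rw [gradient, LinearIsometryEquiv.norm_map, (hasFDerivAt_Gam hc hε p).fderiv]
  rw [h]
  exact (dualDeriv hc ε p).le_opNorm q

theorem IsDualOptimizer.dualDeriv_eq_zero
    (hc : MemLp (fun z : Pt d × Pt d => c z.1 z.2) 2 (P.prod Q)) (hε : 0 < ε)
    {p : DualSpace P Q} (hp : IsDualOptimizer P Q c ε p) : dualDeriv hc ε p = 0 :=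
  IsLocalMax.hasFDerivAt_eq_zero (Filter.Eventually.of_forall hp) (hasFDerivAt_Gam hc hε p)

/-- The derivative only sees `f ⊕ g`, so the direction can be centred: constants may be moved
between the two components, after which `f ⊕ g` and `(f, g)` have the same norm. -/
theorem abs_dualDeriv_apply_le_oplus
    (hc : MemLp (fun z : Pt d × Pt d => c z.1 z.2) 2 (P.prod Q)) (hε : 0 < ε)
    (p q : DualSpace P Q) :
    |dualDeriv hc ε p q|
      ≤ ‖gradient (Gam P Q c ε) p‖ * (eLpNorm (oplus q) 2 (P.prod Q)).toReal := by
  set m := ∫ t, q.fst t ∂P with hm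
  set q' : DualSpace P Q := WithLp.toLp 2
    (q.fst - (memLp_const m).toLp (fun _ => m), q.snd + (memLp_const m).toLp (fun _ => m)) with hq'
  have e1 : q'.fst =ᵐ[P] fun x => q.fst x - m := by
    filter_upwards [Lp.coeFn_sub q.fst ((memLp_const (μ := P) (p := 2) m).toLp (fun _ => m)),
      (memLp_const (μ := P) (p := 2) m).coeFn_toLp] with x h1 h2
    rw [hq', WithLp.toLp_fst, h1, Pi.sub_apply, h2]
  have e2 : q'.snd =ᵐ[Q] fun x => q.snd x + m := by
    filter_upwards [Lp.coeFn_add q.snd ((memLp_const (μ := Q) (p := 2) m).toLp (fun _ => m)),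
      (memLp_const (μ := Q) (p := 2) m).coeFn_toLp] with x h1 h2
    rw [hq', WithLp.toLp_snd, h1, Pi.add_apply, h2]
  have e : oplus q' =ᵐ[P.prod Q] oplus q := by
    filter_upwards [Measure.quasiMeasurePreserving_fst.ae e1,
      Measure.quasiMeasurePreserving_snd.ae e2] with z h1 h2
    simp only [oplus, h1, h2]; ring
  have h1 : dualDeriv hc ε p q = dualDeriv hc ε p q' := by
    rw [dualDeriv_apply, dualDeriv_apply]
    refine integral_congr_ae ?_
    filter_upwards [e] with z hz
    rw [hz]
  have h2 : ‖q'‖ = (eLpNorm (oplus q) 2 (P.prod Q)).toReal := by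
    rw [← sq_eq_sq₀ (norm_nonneg _) ENNReal.toReal_nonneg, eLpNorm_two_toReal_sq (memLp_oplus q),
      WithLp.prod_norm_sq_eq_of_L2, L2_norm_sq_eq_integral, L2_norm_sq_eq_integral]
    have h3 := integral_sq_oplus_eq (Lp.memLp q.fst) (Lp.memLp q.snd)
    rw [show (fun z => oplus q z ^ 2) = fun z => (q.fst z.1 + q.snd z.2) ^ 2 from rfl, h3]
    congr 1
    · refine integral_congr_ae ?_
      filter_upwards [e1] with z hz
      rw [hz]
    · refine integral_congr_ae ?_
      filter_upwards [e2] with z hz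
      rw [hz]
  rw [h1, ← h2]
  exact abs_dualDeriv_apply_le hc hε p q'

end Dual


/-! ### Optimality conditions and Lipschitz potentials -/

section Cost

variable {d : ℕ} {c : Pt d → Pt d → ℝ} {L : ℝ}

theorem continuous_cost
    (hc : ∀ x x' y y', |c x y - c x' y'| ≤ L * (‖x - x'‖ + ‖y - y'‖)) (hL : 0 < L) :
    Continuous fun z : Pt d × Pt d => c z.1 z.2 := by
  refine (LipschitzWith.of_dist_le_mul (K := (2 * L).toNNReal) fun z w => ?_).continuous
  rw [Real.coe_toNNReal _ (by positivity), Real.dist_eq]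
  refine (hc _ _ _ _).trans ?_
  have h1 : ‖z.1 - w.1‖ ≤ dist z w := by rw [← dist_eq_norm]; exact le_max_left _ _
  have h2 : ‖z.2 - w.2‖ ≤ dist z w := by rw [← dist_eq_norm]; exact le_max_right _ _
  calc L * (‖z.1 - w.1‖ + ‖z.2 - w.2‖) ≤ L * (dist z w + dist z w) := by gcongr
    _ = 2 * L * dist z w := by ring

theorem ae_prod_mem_support (P Q : Measure (Pt d)) [IsProbabilityMeasure P]
    [IsProbabilityMeasure Q] : ∀ᵐ z ∂(P.prod Q), z ∈ P.support ×ˢ Q.support := by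
  filter_upwards [Measure.quasiMeasurePreserving_fst.ae (Measure.support_mem_ae (μ := P)),
    Measure.quasiMeasurePreserving_snd.ae (Measure.support_mem_ae (μ := Q))] with z h1 h2
  exact ⟨h1, h2⟩

theorem memLp_of_continuous {P Q : Measure (Pt d)} [IsProbabilityMeasure P]
    [IsProbabilityMeasure Q] (hP : IsCompact P.support) (hQ : IsCompact Q.support)
    {φ : Pt d × Pt d → ℝ} (hφ : Continuous φ) (p : ℝ≥0∞) : MemLp φ p (P.prod Q) := by
  obtain ⟨C, hC⟩ := (hP.prod hQ).exists_bound_of_continuousOn hφ.continuousOn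
  refine MemLp.of_bound hφ.aestronglyMeasurable C ?_
  filter_upwards [ae_prod_mem_support P Q] with z hz using hC z hz

theorem memLp_of_continuous_of_isCompact_support {P : Measure (Pt d)} [IsProbabilityMeasure P]
    (hP : IsCompact P.support) {φ : Pt d → ℝ} (hφ : Continuous φ) (p : ℝ≥0∞) : MemLp φ p P := by
  obtain ⟨C, hC⟩ := hP.exists_bound_of_continuousOn hφ.continuousOn
  refine MemLp.of_bound hφ.aestronglyMeasurable C ?_
  filter_upwards [Measure.support_mem_ae (μ := P)] with z hz using hC z hz

end Cost

theorem ae_integral_eq_zero_of_forall_setIntegral {X Y : Type*} [MeasurableSpace X]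
    [MeasurableSpace Y] {μ : Measure X} {ν : Measure Y} [IsFiniteMeasure μ] [IsFiniteMeasure ν]
    {w : X × Y → ℝ} (hw : Integrable w (μ.prod ν))
    (h : ∀ s, MeasurableSet s → ∫ z, w z * s.indicator 1 z.1 ∂(μ.prod ν) = 0) :
    ∀ᵐ x ∂μ, ∫ y, w (x, y) ∂ν = 0 := by
  refine Integrable.ae_eq_zero_of_forall_setIntegral_eq_zero hw.integral_prod_left
    fun s hs _ => ?_
  have h1 := h s hs
  have e : (fun z : X × Y => w z * s.indicator 1 z.1) = (s ×ˢ univ).indicator w := by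
    ext ⟨x, y⟩
    by_cases hx : x ∈ s <;> simp [hx]
  rw [e, integral_indicator (hs.prod MeasurableSet.univ),
    setIntegral_prod _ hw.integrableOn] at h1
  simpa using h1

section FirstOrder

variable {d : ℕ} {P Q : Measure (Pt d)} [IsProbabilityMeasure P] [IsProbabilityMeasure Q]
  {c : Pt d → Pt d → ℝ} {ε : ℝ}

/-- First-order conditions: the function `(f ⊕ g - c)₊ / ε` is the density of a coupling. -/
theorem IsDualOptimizer.ae_integral_eq
    (hc : MemLp (fun z : Pt d × Pt d => c z.1 z.2) 2 (P.prod Q)) (hε : 0 < ε)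
    {p : DualSpace P Q} (hp : IsDualOptimizer P Q c ε p) :
    (∀ᵐ x ∂P, ∫ y, max (p.fst x + p.snd y - c x y) 0 ∂Q = ε) ∧
    (∀ᵐ y ∂Q, ∫ x, max (p.fst x + p.snd y - c x y) 0 ∂P = ε) := by
  set w : Pt d × Pt d → ℝ := fun z => 1 - ε⁻¹ * max (oplus p z - c z.1 z.2) 0 with hw
  have hm : Integrable (fun z : Pt d × Pt d => max (oplus p z - c z.1 z.2) 0) (P.prod Q) :=
    (memLp_max_sub (memLp_oplus p) hc).integrable one_le_two
  have hwi : Integrable w (P.prod Q) := (memLp_slope (memLp_oplus p) hc ε).integrable one_le_two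
  have key : ∀ q : DualSpace P Q, ∫ z, w z * oplus q z ∂(P.prod Q) = 0 := fun q => by
    rw [← dualDeriv_apply hc ε p q, hp.dualDeriv_eq_zero hc hε]; rfl
  constructor
  · have h1 : ∀ᵐ x ∂P, ∫ y, w (x, y) ∂Q = 0 := by
      refine ae_integral_eq_zero_of_forall_setIntegral hwi fun s hs => ?_
      rw [← key (WithLp.toLp 2 (indicatorConstLp 2 hs (measure_ne_top P s) (1 : ℝ), 0))]
      refine integral_congr_ae ?_
      filter_upwards [Measure.quasiMeasurePreserving_fst.ae (indicatorConstLp_coeFn (p := 2)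
        (hs := hs) (hμs := measure_ne_top P s) (c := (1 : ℝ))),
        Measure.quasiMeasurePreserving_snd.ae (Lp.coeFn_zero ℝ 2 Q)] with z e1 e2
      simp only [oplus, WithLp.toLp_fst, WithLp.toLp_snd, e1, e2]
      simp [indicator]
    filter_upwards [h1, hm.prod_right_ae] with x hx hi
    simp only [hw] at hx
    rw [integral_sub (integrable_const _) (hi.const_mul _), integral_const_mul] at hx
    have : ε⁻¹ * ∫ y, max (oplus p (x, y) - c x y) 0 ∂Q = 1 := by
      simp only [integral_const, probReal_univ, smul_eq_mul, mul_one] at hx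
      linarith
    rwa [inv_mul_eq_one₀ hε.ne', eq_comm] at this
  · have h1 : ∀ᵐ y ∂Q, ∫ x, w (x, y) ∂P = 0 := by
      refine ae_integral_eq_zero_of_forall_setIntegral (w := w ∘ Prod.swap) hwi.swap
        fun s hs => ?_
      rw [← key (WithLp.toLp 2 (0, indicatorConstLp 2 hs (measure_ne_top Q s) (1 : ℝ))),
        ← integral_prod_swap]
      refine integral_congr_ae ?_
      filter_upwards [Measure.quasiMeasurePreserving_snd.ae (indicatorConstLp_coeFn (p := 2)
        (hs := hs) (hμs := measure_ne_top Q s) (c := (1 : ℝ))),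
        Measure.quasiMeasurePreserving_fst.ae (Lp.coeFn_zero ℝ 2 P)] with z e1 e2
      simp only [oplus, WithLp.toLp_fst, WithLp.toLp_snd, e1, e2]
      simp [indicator]
    filter_upwards [h1, hm.prod_left_ae] with y hy hi
    simp only [hw] at hy
    rw [integral_sub (integrable_const _) (hi.const_mul _), integral_const_mul] at hy
    have : ε⁻¹ * ∫ x, max (oplus p (x, y) - c x y) 0 ∂P = 1 := by
      simp only [integral_const, probReal_univ, smul_eq_mul, mul_one] at hy
      linarith
    rwa [inv_mul_eq_one₀ hε.ne', eq_comm] at this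

/-- A potential `f` that solves `∫ (f x + g y - b x y)₊ dν(y) = ε` inherits the Lipschitz constant
of `b`, since the left-hand side is strictly increasing in `f x` where it is positive. -/
theorem exists_lipschitzWith_ae_eq {X Y : Type*} [PseudoMetricSpace X] [MeasurableSpace X]
    [MeasurableSpace Y] {μ : Measure X} {ν : Measure Y} [IsFiniteMeasure ν] {f : X → ℝ} {g : Y → ℝ}
    {b : X → Y → ℝ} {L : ℝ≥0} (hε : 0 < ε) (hg : Integrable g ν)
    (hb : ∀ x, Integrable (b x) ν) (hL : ∀ x x' y, b x' y - b x y ≤ L * dist x x')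
    (h : ∀ᵐ x ∂μ, ∫ y, max (f x + g y - b x y) 0 ∂ν = ε) :
    ∃ F : X → ℝ, LipschitzWith L F ∧ f =ᵐ[μ] F := by
  set S := {x | ∫ y, max (f x + g y - b x y) 0 ∂ν = ε} with hS
  have hint : ∀ x (t : ℝ), Integrable (fun y => max (t + g y - b x y) 0) ν := fun x t =>
    (((integrable_const t).add hg).sub (hb x)).sup (integrable_zero _ _ _)
  have hf : LipschitzOnWith L f S := by
    refine LipschitzOnWith.of_le_add_mul L fun x' hx' x hx => ?_
    by_contra! hlt
    -- the integrand at `x'` then exceeds the one at `x`, strictly where the latter is positive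
    have hle : ∀ y, max (f x + g y - b x y) 0 ≤ max (f x' + g y - b x' y) 0 := fun y => by
      have := hL x x' y
      rw [dist_comm] at this
      exact max_le_max_right _ (by linarith)
    have heq := (integral_eq_iff_of_ae_le (hint x (f x)) (hint x' (f x'))
      (ae_of_all _ hle)).1 (hx.trans hx'.symm)
    have hzero : (fun y => max (f x + g y - b x y) 0) =ᵐ[ν] 0 := by
      filter_upwards [heq] with y hy
      by_contra h0
      have hpos : 0 < f x + g y - b x y := by
        by_contra! hn
        exact h0 (max_eq_right hn)
      have h1 := hL x x' y
      rw [dist_comm] at h1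
      have h2 := le_max_left (f x' + g y - b x' y) 0
      rw [max_eq_left hpos.le] at hy
      linarith
    have h0 : ∫ y, max (f x + g y - b x y) 0 ∂ν = 0 := by
      rw [integral_congr_ae hzero]; simp
    exact hε.ne' (hx.symm.trans h0)
  obtain ⟨F, hF, hFS⟩ := hf.extend_real
  refine ⟨F, hF, ?_⟩
  filter_upwards [h] with x hx using hFS hx

theorem exists_mem_support_le {φ : Pt d → ℝ} {t : ℝ} (ht : 0 < t)
    (h : ∫ y, max (φ y) 0 ∂Q = t) : ∃ y ∈ Q.support, t ≤ φ y := by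
  have hi : Integrable (fun y => max (φ y) 0) Q := by
    by_contra hn
    rw [integral_undef hn] at h
    exact ht.ne h
  obtain ⟨y, hy, hle⟩ := exists_notMem_null_integral_le hi (Measure.measure_compl_support (μ := Q))
  rw [h] at hle
  refine ⟨y, not_not.1 hy, ?_⟩
  by_contra! hn
  exact absurd hle (not_le.2 (max_lt hn ht))

/-- Optimal potentials agree almost everywhere with Lipschitz functions. -/
theorem IsDualOptimizer.exists_lipschitz {L : ℝ} (hP : IsCompact P.support)
    (hQ : IsCompact Q.support) (hL : 0 < L)
    (hc : ∀ x x' y y', |c x y - c x' y'| ≤ L * (‖x - x'‖ + ‖y - y'‖)) (hε : 0 < ε)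
    {p : DualSpace P Q} (hp : IsDualOptimizer P Q c ε p) :
    ∃ F G : Pt d → ℝ, LipschitzWith L.toNNReal F ∧ LipschitzWith L.toNNReal G ∧
      p.fst =ᵐ[P] F ∧ p.snd =ᵐ[Q] G ∧
      (∀ᵐ x ∂P, ∫ y, max (F x + G y - c x y) 0 ∂Q = ε) ∧
      (∀ᵐ y ∂Q, ∫ x, max (F x + G y - c x y) 0 ∂P = ε) := by
  have hcont := continuous_cost hc hL
  obtain ⟨h1, h2⟩ := hp.ae_integral_eq (memLp_of_continuous hP hQ hcont 2) hε
  have hi1 : ∀ x, Integrable (c x) Q := fun x => memLp_one_iff_integrable.1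
    (memLp_of_continuous_of_isCompact_support hQ (hcont.comp (Continuous.prodMk_right x)) 1)
  have hi2 : ∀ y, Integrable (fun x => c x y) P := fun y => memLp_one_iff_integrable.1
    (memLp_of_continuous_of_isCompact_support hP (hcont.comp (Continuous.prodMk_left y)) 1)
  obtain ⟨F, hF, hfF⟩ := exists_lipschitzWith_ae_eq (L := L.toNNReal) hε
    ((Lp.memLp p.snd).integrable one_le_two) hi1 (fun x x' y => by
      have := (abs_le.1 (hc x' x y y)).2
      rwa [sub_self, norm_zero, add_zero, ← dist_eq_norm, dist_comm,
        ← Real.coe_toNNReal L hL.le] at this) h1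
  have h2' : ∀ᵐ y ∂Q, ∫ x, max (p.snd y + p.fst x - c x y) 0 ∂P = ε := by
    simpa only [add_comm (p.snd _)] using h2
  obtain ⟨G, hG, hgG⟩ := exists_lipschitzWith_ae_eq (b := fun y x => c x y) (L := L.toNNReal) hε
    ((Lp.memLp p.fst).integrable one_le_two) hi2 (fun y y' x => by
      have := (abs_le.1 (hc x x y' y)).2
      rwa [sub_self, norm_zero, zero_add, ← dist_eq_norm, dist_comm,
        ← Real.coe_toNNReal L hL.le] at this)
    h2'
  refine ⟨F, G, hF, hG, hfF, hgG, ?_, ?_⟩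
  · filter_upwards [h1, hfF] with x hx hxF
    rw [← hx]
    refine integral_congr_ae ?_
    filter_upwards [hgG] with y hy
    rw [hxF, hy]
  · filter_upwards [h2, hgG] with y hy hyG
    rw [← hy]
    refine integral_congr_ae ?_
    filter_upwards [hfF] with x hx
    rw [hx, hyG]

end FirstOrder


/-! ### The primal value and duality -/

theorem IsCoupling.ae_mem_support {d : ℕ} {P Q : Measure (Pt d)}
    {π : Measure (Pt d × Pt d)} (h : IsCoupling P Q π) :
    ∀ᵐ z ∂π, z ∈ P.support ×ˢ Q.support := by
  have h1 : ∀ᵐ x ∂(π.map Prod.fst), x ∈ P.support := by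
    rw [h.map_fst]; exact Measure.support_mem_ae
  have h2 : ∀ᵐ y ∂(π.map Prod.snd), y ∈ Q.support := by
    rw [h.map_snd]; exact Measure.support_mem_ae
  filter_upwards [ae_of_ae_map measurable_fst.aemeasurable h1,
    ae_of_ae_map measurable_snd.aemeasurable h2] with z e1 e2 using ⟨e1, e2⟩

theorem value_ne_bot {d : ℕ} {P Q : Measure (Pt d)} [IsProbabilityMeasure P]
    {c : Pt d → Pt d → ℝ} {ε : ℝ} (hP : IsCompact P.support) (hQ : IsCompact Q.support)
    (hcont : Continuous fun z : Pt d × Pt d => c z.1 z.2) : value P Q c ε ≠ ⊥ := by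
  obtain ⟨C, hC⟩ := (hP.prod hQ).exists_bound_of_continuousOn hcont.continuousOn
  refine ne_bot_of_le_ne_bot (EReal.coe_ne_bot (-C)) (le_iInf₂ fun π hπ => ?_)
  have : IsProbabilityMeasure π := ⟨by
    rw [← preimage_univ (f := (Prod.fst : Pt d × Pt d → Pt d)),
      ← Measure.map_apply measurable_fst MeasurableSet.univ, hπ.map_fst, measure_univ]⟩
  have h1 : ‖∫ z, c z.1 z.2 ∂π‖ ≤ C * π.real univ :=
    norm_integral_le_of_norm_le_const (hπ.ae_mem_support.mono hC)
  rw [probReal_univ, mul_one, Real.norm_eq_abs] at h1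
  calc ((-C : ℝ) : EReal) ≤ ((∫ z, c z.1 z.2 ∂π : ℝ) : EReal) :=
        EReal.coe_le_coe_iff.2 (abs_le.1 h1).1
    _ ≤ _ := le_add_of_nonneg_right (EReal.coe_ennreal_nonneg _)

section Primal

variable {d : ℕ} {P Q : Measure (Pt d)} [IsProbabilityMeasure P] [IsProbabilityMeasure Q]
  {c : Pt d → Pt d → ℝ} {ε : ℝ}

theorem value_ne_top : value P Q c ε ≠ ⊤ := by
  have hc : IsCoupling P Q (P.prod Q) := ⟨by simp, by simp⟩
  have hs : sqNormDensity (P.prod Q) (P.prod Q) = 1 := by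
    rw [sqNormDensity, if_pos Measure.AbsolutelyContinuous.rfl]
    have : ∫⁻ z, ((P.prod Q).rnDeriv (P.prod Q) z) ^ 2 ∂(P.prod Q) = ∫⁻ _, 1 ∂(P.prod Q) := by
      refine lintegral_congr_ae ?_
      filter_upwards [Measure.rnDeriv_self (P.prod Q)] with z hz
      rw [hz, one_pow]
    rw [this]; simp
  refine ne_top_of_le_ne_top ?_ (iInf₂_le (P.prod Q) hc)
  rw [hs, mul_one]
  exact EReal.add_ne_top (EReal.coe_ne_top _) (by simp)

theorem sqNormDensity_withDensity {X : Type*} [MeasurableSpace X] {μ : Measure X} [SigmaFinite μ]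
    {κ : X → ℝ} (hκ : Measurable κ) (hκ2 : MemLp κ 2 μ) (h0 : ∀ z, 0 ≤ κ z) :
    sqNormDensity (μ.withDensity fun z => ENNReal.ofReal (κ z)) μ
      = ENNReal.ofReal (∫ z, κ z ^ 2 ∂μ) := by
  rw [sqNormDensity, if_pos (withDensity_absolutelyContinuous _ _),
    ofReal_integral_eq_lintegral_ofReal hκ2.integrable_sq (ae_of_all _ fun _ => sq_nonneg _)]
  refine lintegral_congr_ae ?_
  filter_upwards [Measure.rnDeriv_withDensity μ hκ.ennreal_ofReal] with z hz
  rw [hz, ENNReal.ofReal_pow (h0 z)]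

theorem isCoupling_withDensity {κ : Pt d × Pt d → ℝ} (hκ : Measurable κ)
    (hi : Integrable κ (P.prod Q)) (h0 : ∀ z, 0 ≤ κ z) (h1 : ∀ᵐ x ∂P, ∫ y, κ (x, y) ∂Q = 1)
    (h2 : ∀ᵐ y ∂Q, ∫ x, κ (x, y) ∂P = 1) :
    IsCoupling P Q ((P.prod Q).withDensity fun z => ENNReal.ofReal (κ z)) := by
  constructor
  · ext s hs
    rw [Measure.map_apply measurable_fst hs, withDensity_apply _ (measurable_fst hs),
      ← prod_univ, ← Measure.prod_restrict, lintegral_prod _ (by fun_prop), Measure.restrict_univ]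
    have : ∀ᵐ x ∂(P.restrict s), ∫⁻ y, ENNReal.ofReal (κ (x, y)) ∂Q = 1 := by
      refine ae_restrict_of_ae ?_
      filter_upwards [h1, hi.prod_right_ae] with x hx hxi
      rw [← ofReal_integral_eq_lintegral_ofReal hxi (ae_of_all _ fun _ => h0 _), hx,
        ENNReal.ofReal_one]
    rw [lintegral_congr_ae this]
    simp
  · ext s hs
    rw [Measure.map_apply measurable_snd hs, withDensity_apply _ (measurable_snd hs),
      ← univ_prod, ← Measure.prod_restrict, lintegral_prod_symm _ (by fun_prop),
      Measure.restrict_univ]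
    have : ∀ᵐ y ∂(Q.restrict s), ∫⁻ x, ENNReal.ofReal (κ (x, y)) ∂P = 1 := by
      refine ae_restrict_of_ae ?_
      filter_upwards [h2, hi.prod_left_ae] with y hy hyi
      rw [← ofReal_integral_eq_lintegral_ofReal hyi (ae_of_all _ fun _ => h0 _), hy,
        ENNReal.ofReal_one]
    rw [lintegral_congr_ae this]
    simp

/-- Absence of a duality gap: the coupling with density `(f ⊕ g - c)₊ / ε`, for optimal `(f, g)`,
has transport cost `Γ(f, g)`. -/
theorem IsDualOptimizer.value_le_Gam {L : ℝ} (hP : IsCompact P.support)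
    (hQ : IsCompact Q.support) (hL : 0 < L)
    (hc : ∀ x x' y y', |c x y - c x' y'| ≤ L * (‖x - x'‖ + ‖y - y'‖)) (hε : 0 < ε)
    {p : DualSpace P Q} (hp : IsDualOptimizer P Q c ε p) :
    value P Q c ε ≤ (Gam P Q c ε p : EReal) := by
  obtain ⟨F, G, hF, hG, hfF, hgG, h1, h2⟩ := hp.exists_lipschitz hP hQ hL hc hε
  have hcont := continuous_cost hc hL
  have hFc := hF.continuous
  have hGc := hG.continuous
  set μ := P.prod Q with hμ
  set κ : Pt d × Pt d → ℝ := fun z => ε⁻¹ * max (F z.1 + G z.2 - c z.1 z.2) 0 with hκ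
  have hκc : Continuous κ := by fun_prop
  have hmem : ∀ {φ : Pt d × Pt d → ℝ}, Continuous φ → MemLp φ 2 μ :=
    fun hφ => memLp_of_continuous hP hQ hφ 2
  have hint : ∀ {φ : Pt d × Pt d → ℝ}, Continuous φ → Integrable φ μ :=
    fun hφ => (hmem hφ).integrable one_le_two
  have h0 : ∀ z, 0 ≤ κ z := fun z => by positivity
  have k1 : ∀ᵐ x ∂P, ∫ y, κ (x, y) ∂Q = 1 := by
    filter_upwards [h1] with x hx
    simp only [hκ]
    rw [integral_const_mul, hx, inv_mul_cancel₀ hε.ne']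
  have k2 : ∀ᵐ y ∂Q, ∫ x, κ (x, y) ∂P = 1 := by
    filter_upwards [h2] with y hy
    simp only [hκ]
    rw [integral_const_mul, hy, inv_mul_cancel₀ hε.ne']
  have hπ := isCoupling_withDensity hκc.measurable (hint hκc) h0 k1 k2
  refine (iInf₂_le _ hπ).trans ?_
  rw [sqNormDensity_withDensity hκc.measurable (hmem hκc) h0,
    ← ENNReal.ofReal_mul (by positivity), EReal.coe_ennreal_ofReal,
    max_eq_left (mul_nonneg (by positivity) (integral_nonneg fun _ => sq_nonneg _)),
    ← EReal.coe_add, EReal.coe_le_coe_iff,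
    integral_withDensity_eq_integral_toReal_smul (by fun_prop) (ae_of_all _ fun _ => by simp)]
  -- the marginals of `κ` allow to weight `F ⊕ G` by `κ`
  have hFκ : ∫ z, κ z * F z.1 ∂μ = ∫ x, F x ∂P := by
    rw [hμ, integral_prod _ (hint (by fun_prop))]
    refine integral_congr_ae ?_
    filter_upwards [k1] with x hx
    rw [integral_mul_const, hx, one_mul]
  have hGκ : ∫ z, κ z * G z.2 ∂μ = ∫ y, G y ∂Q := by
    rw [hμ, integral_prod_symm _ (hint (by fun_prop))]
    refine integral_congr_ae ?_
    filter_upwards [k2] with y hy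
    rw [integral_mul_const, hy, one_mul]
  have hGam : Gam P Q c ε p = ∫ z, (F z.1 + G z.2 - ε / 2 * κ z ^ 2) ∂μ := by
    refine integral_congr_ae ?_
    filter_upwards [Measure.quasiMeasurePreserving_fst.ae hfF,
      Measure.quasiMeasurePreserving_snd.ae hgG] with z e1 e2
    simp only [oplus, e1, e2, hκ]
    field_simp
  have hsplit : ∫ z, (F z.1 + G z.2 - ε / 2 * κ z ^ 2) ∂μ
      = ∫ z, κ z * F z.1 ∂μ + ∫ z, κ z * G z.2 ∂μ - ε / 2 * ∫ z, κ z ^ 2 ∂μ := by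
    rw [integral_sub (hint (by fun_prop)) (hint (by fun_prop)),
      integral_add (hint (by fun_prop)) (hint (by fun_prop)), integral_const_mul, hFκ, hGκ, hμ,
      integral_fun_fst F, integral_fun_snd G]
    simp
  have hcost : ∫ z, (ENNReal.ofReal (κ z)).toReal • c z.1 z.2 ∂μ
      = ∫ z, κ z * F z.1 ∂μ + ∫ z, κ z * G z.2 ∂μ - ε * ∫ z, κ z ^ 2 ∂μ := by
    rw [← integral_const_mul, ← integral_add (hint (by fun_prop)) (hint (by fun_prop)),
      ← integral_sub (hint (by fun_prop)) (hint (by fun_prop))]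
    refine integral_congr_ae (ae_of_all _ fun z => ?_)
    simp only
    rw [ENNReal.toReal_ofReal (h0 z), smul_eq_mul]
    -- on `{κ ≠ 0}` the relation `ε κ = F ⊕ G - c` holds
    rcases le_total (F z.1 + G z.2 - c z.1 z.2) 0 with h | h
    · have : κ z = 0 := by simp only [hκ]; rw [max_eq_right h, mul_zero]
      rw [this]; ring
    · have : ε * κ z = F z.1 + G z.2 - c z.1 z.2 := by
        simp only [hκ]; rw [max_eq_left h]; field_simp
      linear_combination κ z * this
  rw [hcost, hGam, hsplit]
  linarith

end Primal

/-! ### The error bound and the Polyak–Łojasiewicz inequality -/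

theorem gammaConst_nonneg {d : ℕ} (P Q : Measure (Pt d)) {δ : ℝ} (hδ : 0 ≤ δ) (lam Lam L ε : ℝ) :
    0 ≤ gammaConst P Q δ lam Lam L ε := by
  have h : 0 ≤ ⨅ y : Q.support, Q.real (Metric.ball (y : Pt d) (ε / (8 * L))) :=
    Real.iInf_nonneg fun y => measureReal_nonneg
  unfold gammaConst
  positivity

/-- The error bound in squared form, with the directional derivative in place of the gradient. -/
theorem IsDualOptimizer.eLpNorm_sq_le {d : ℕ} (hd : 1 ≤ d) {P Q : Measure (Pt d)}
    [IsProbabilityMeasure P] [IsProbabilityMeasure Q] {ρ : Pt d → ℝ} {lam Lam δ L ε : ℝ}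
    {c : Pt d → Pt d → ℝ} (hP : IsCompact P.support) (hconv : Convex ℝ P.support)
    (hQ : IsCompact Q.support) (hlam : 0 < lam) (hρ : HasDensityBounds P ρ lam Lam)
    (hδ : IsBallMassConstant P δ) (hL : 0 < L)
    (hc : ∀ x x' y y', |c x y - c x' y'| ≤ L * (‖x - x'‖ + ‖y - y'‖)) (hε : 0 < ε)
    (hc2 : MemLp (fun z : Pt d × Pt d => c z.1 z.2) 2 (P.prod Q))
    {pstar : DualSpace P Q} (hp : IsDualOptimizer P Q c ε pstar) (p : DualSpace P Q) {M : ℝ}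
    (hM : ∀ᵐ z ∂(P.prod Q), |oplus p z - oplus pstar z| ≤ M) :
    (eLpNorm (oplus (p - pstar)) 2 (P.prod Q)).toReal ^ 2
      ≤ gammaConst P Q δ lam Lam L ε * max M ε * -dualDeriv hc2 ε p (p - pstar) := by
  obtain ⟨F, G, hF, hG, hfF, hgG, h1, h2⟩ := hp.exists_lipschitz hP hQ hL hc hε
  set q := p - pstar with hq
  set μ := P.prod Q with hμ
  set ξ : Pt d → Pt d → ℝ := fun x y => F x + G y - c x y with hξ
  set u : Pt d → ℝ := fun x => p.fst x - F x with hu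
  set v : Pt d → ℝ := fun y => p.snd y - G y with hv
  have hcont := continuous_cost hc hL
  have hFc := hF.continuous
  have hGc := hG.continuous
  have hξm : Measurable fun z : Pt d × Pt d => ξ z.1 z.2 :=
    Continuous.measurable (by simp only [hξ]; fun_prop)
  have hξL : ∀ x x' y y', |ξ x y - ξ x' y'| ≤ 2 * L * (‖x - x'‖ + ‖y - y'‖) := by
    intro x x' y y'
    have e1 := hF.dist_le_mul x x'
    have e2 := hG.dist_le_mul y y'
    rw [Real.dist_eq, dist_eq_norm, Real.coe_toNNReal L hL.le, abs_le] at e1 e2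
    have e3 := abs_le.1 (hc x x' y y')
    rw [abs_le]
    simp only [hξ]
    constructor <;> linarith [e1.1, e1.2, e2.1, e2.2, e3.1, e3.2]
  have hx : ∀ᵐ x ∂P, ∃ y ∈ Q.support, ε ≤ ξ x y :=
    h1.mono fun x hx => exists_mem_support_le hε hx
  have hy : ∀ᵐ y ∂Q, ∃ x ∈ P.support, ε ≤ ξ x y :=
    h2.mono fun y hy => exists_mem_support_le hε hy
  have hum : Measurable u := (Lp.stronglyMeasurable p.fst).measurable.sub hFc.measurable
  have hvm : Measurable v := (Lp.stronglyMeasurable p.snd).measurable.sub hGc.measurable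
  have hu2 : MemLp u 2 P :=
    (Lp.memLp p.fst).sub (memLp_of_continuous_of_isCompact_support hP hFc 2)
  have hv2 : MemLp v 2 Q :=
    (Lp.memLp p.snd).sub (memLp_of_continuous_of_isCompact_support hQ hGc 2)
  have hpstar : oplus pstar =ᵐ[μ] fun z => F z.1 + G z.2 := by
    filter_upwards [Measure.quasiMeasurePreserving_fst.ae hfF,
      Measure.quasiMeasurePreserving_snd.ae hgG] with z e1 e2
    simp only [oplus, e1, e2]
  have hquv : oplus q =ᵐ[μ] fun z => u z.1 + v z.2 := by
    filter_upwards [hpstar, oplus_sub p pstar] with z e1 e2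
    rw [e2, e1]
    simp only [oplus, hu, hv]; ring
  have hmain := integral_sq_oplus_le_level hd hP hconv hQ hlam hρ hδ hL hε hξm hξL hx hy
    hum hvm hu2 hv2
  set J := ∫ z in {z : Pt d × Pt d | ε / 2 ≤ ξ z.1 z.2}, (u z.1 + v z.2) ^ 2 ∂μ with hJ
  have hn : (eLpNorm (oplus q) 2 μ).toReal ^ 2 = ∫ z, (u z.1 + v z.2) ^ 2 ∂μ := by
    rw [eLpNorm_two_toReal_sq (memLp_oplus q)]
    refine integral_congr_ae ?_
    filter_upwards [hquv] with z hz
    rw [hz]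
  set D : Pt d × Pt d → ℝ := fun z =>
    (max (oplus p z - c z.1 z.2) 0 - max (oplus pstar z - c z.1 z.2) 0) * oplus q z with hD
  have hmp := memLp_max_sub (memLp_oplus p) hc2
  have hms := memLp_max_sub (memLp_oplus pstar) hc2
  have hDi : Integrable D μ := (hmp.sub hms).integrable_mul (memLp_oplus q)
  -- the derivative vanishes at the optimizer, hence compare the derivatives at both points
  have hderiv : -dualDeriv hc2 ε p q = ε⁻¹ * ∫ z, D z ∂μ := by
    have e0 : dualDeriv hc2 ε pstar q = 0 := by rw [hp.dualDeriv_eq_zero hc2 hε]; rfl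
    have e1 : -dualDeriv hc2 ε p q = dualDeriv hc2 ε pstar q - dualDeriv hc2 ε p q := by
      rw [e0, zero_sub]
    have hi : ∀ p' : DualSpace P Q, Integrable
        (fun z => (1 - ε⁻¹ * max (oplus p' z - c z.1 z.2) 0) * oplus q z) (P.prod Q) :=
      fun p' => (memLp_slope (memLp_oplus p') hc2 ε).integrable_mul (memLp_oplus q)
    rw [e1, dualDeriv_apply, dualDeriv_apply, ← integral_sub (hi pstar) (hi p),
      ← integral_const_mul]
    refine integral_congr_ae (ae_of_all _ fun z => ?_)
    simp only [hD]; ring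
  have hadd : ∀ᵐ z ∂μ, oplus p z - c z.1 z.2 = oplus pstar z - c z.1 z.2 + oplus q z := by
    filter_upwards [oplus_sub p pstar] with z hz
    rw [hz]; ring
  have hD0 : 0 ≤ᵐ[μ] D := by
    filter_upwards [hadd] with z hz
    simp only [hD, hz]
    exact max_add_sub_mul_nonneg _ _
  have hset : MeasurableSet {z : Pt d × Pt d | ε / 2 ≤ ξ z.1 z.2} :=
    measurableSet_le measurable_const hξm
  have hJD : ε / (2 * max M ε) * J ≤ ∫ z, D z ∂μ := by
    refine le_trans ?_ (setIntegral_le_integral (s := {z | ε / 2 ≤ ξ z.1 z.2}) hDi hD0)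
    rw [hJ, ← integral_const_mul]
    have hi : Integrable (fun z : Pt d × Pt d => (u z.1 + v z.2) ^ 2) μ :=
      ((hu2.comp_fst Q).add (hv2.comp_snd P)).integrable_sq
    refine integral_mono_ae (hi.integrableOn.const_mul _) hDi.integrableOn ?_
    filter_upwards [ae_restrict_mem hset, ae_restrict_of_ae hadd, ae_restrict_of_ae hquv,
      ae_restrict_of_ae hM, ae_restrict_of_ae hpstar, ae_restrict_of_ae (oplus_sub p pstar)]
      with z hz e1 e2 e3 e4 e5
    simp only [hD, e1]
    rw [← e2]
    refine div_mul_sq_le_max_add_sub_mul hε ?_ (by rwa [e5])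
    rw [e4]; exact hz
  have hγ := gammaConst_nonneg P Q hδ.pos.le lam Lam L ε
  have hK : 0 < max M ε := hε.trans_le (le_max_right _ _)
  have hJle : J ≤ 2 * max M ε * (ε⁻¹ * ∫ z, D z ∂μ) := by
    calc J = 2 * max M ε * (ε⁻¹ * (ε / (2 * max M ε) * J)) := by field_simp
      _ ≤ _ := by gcongr
  rw [hn, hderiv]
  calc _ ≤ gammaConst P Q δ lam Lam L ε / 2 * J := hmain
    _ ≤ gammaConst P Q δ lam Lam L ε / 2 * (2 * max M ε * (ε⁻¹ * ∫ z, D z ∂μ)) := by gcongr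
    _ = _ := by ring

end QOT

end

theorem mainTheorem1 {d : ℕ} (hd : 1 ≤ d) (Ω : Set (QOT.Pt d)) (hΩ_compact : IsCompact Ω)
    (hΩ_convex : Convex ℝ Ω) (lam : ℝ) (hlam : 0 < lam) :
    -- a ball mass constant exists that depends only on `Ω` and the lower density bound
    (∃ δ : ℝ, 0 < δ ∧ δ ≤ 1 ∧
      ∀ (P : Measure (QOT.Pt d)) (ρ : QOT.Pt d → ℝ) (Lam : ℝ), IsProbabilityMeasure P →
        P.support = Ω → QOT.HasDensityBounds P ρ lam Lam → QOT.IsBallMassConstant P δ) ∧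
    -- the error bound and the PL inequality
    ∀ (P Q : Measure (QOT.Pt d)) [IsProbabilityMeasure P] [IsProbabilityMeasure Q]
      (ρ : QOT.Pt d → ℝ) (Lam δ L ε : ℝ) (c : QOT.Pt d → QOT.Pt d → ℝ),
      P.support = Ω → QOT.HasDensityBounds P ρ lam Lam → QOT.IsBallMassConstant P δ →
      IsCompact Q.support →
      0 < L → (∀ x x' y y', |c x y - c x' y'| ≤ L * (‖x - x'‖ + ‖y - y'‖)) →
      0 < ε →
      QOT.value P Q c ε ≠ ⊤ ∧ QOT.value P Q c ε ≠ ⊥ ∧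
      ∀ pstar : QOT.DualSpace P Q, QOT.IsDualOptimizer P Q c ε pstar →
      ∀ p : QOT.DualSpace P Q, MemLp p.fst ∞ P → MemLp p.snd ∞ Q →
        DifferentiableAt ℝ (QOT.Gam P Q c ε) p ∧
        MemLp (QOT.oplus p - QOT.oplus pstar) ∞ (P.prod Q) ∧
        (eLpNorm (QOT.oplus p - QOT.oplus pstar) 2 (P.prod Q)).toReal
          ≤ QOT.gammaConst P Q δ lam Lam L ε
            * max (eLpNorm (QOT.oplus p - QOT.oplus pstar) ∞ (P.prod Q)).toReal ε
            * ‖gradient (QOT.Gam P Q c ε) p‖ ∧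
        1 / (QOT.gammaConst P Q δ lam Lam L ε
            * max (eLpNorm (QOT.oplus p - QOT.oplus pstar) ∞ (P.prod Q)).toReal ε)
            * ((QOT.value P Q c ε).toReal - QOT.Gam P Q c ε p)
          ≤ ‖gradient (QOT.Gam P Q c ε) p‖ ^ 2 := by
  refine ⟨QOT.exists_isBallMassConstant hΩ_compact hΩ_convex hlam, ?_⟩
  rintro P Q _ _ ρ Lam δ L ε c rfl hρ hδ hQ hL hc hε
  have hcont := QOT.continuous_cost hc hL
  have hbot := QOT.value_ne_bot (ε := ε) hΩ_compact hQ hcont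
  refine ⟨QOT.value_ne_top, hbot, fun pstar hp p hp1 hp2 => ?_⟩
  have hc2 := QOT.memLp_of_continuous hΩ_compact hQ hcont 2
  obtain ⟨F, G, hF, hG, hfF, hgG, -, -⟩ := hp.exists_lipschitz hΩ_compact hQ hL hc hε
  have hs1 : MemLp pstar.fst ∞ P :=
    (memLp_congr_ae hfF).2 (QOT.memLp_of_continuous_of_isCompact_support hΩ_compact hF.continuous _)
  have hs2 : MemLp pstar.snd ∞ Q :=
    (memLp_congr_ae hgG).2 (QOT.memLp_of_continuous_of_isCompact_support hQ hG.continuous _)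
  have hinf : MemLp (QOT.oplus p - QOT.oplus pstar) ∞ (P.prod Q) :=
    ((hp1.comp_fst Q).add (hp2.comp_snd P)).sub ((hs1.comp_fst Q).add (hs2.comp_snd P))
  set M := (eLpNorm (QOT.oplus p - QOT.oplus pstar) ∞ (P.prod Q)).toReal with hMdef
  have hM : ∀ᵐ z ∂(P.prod Q), |QOT.oplus p z - QOT.oplus pstar z| ≤ M := by
    filter_upwards [ae_le_eLpNormEssSup (f := QOT.oplus p - QOT.oplus pstar) (μ := P.prod Q)]
      with z hz
    rw [← eLpNorm_exponent_top] at hz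
    have := ENNReal.toReal_mono hinf.eLpNorm_ne_top hz
    rwa [toReal_enorm] at this
  have hnorm : eLpNorm (QOT.oplus p - QOT.oplus pstar) 2 (P.prod Q)
      = eLpNorm (QOT.oplus (p - pstar)) 2 (P.prod Q) :=
    eLpNorm_congr_ae (QOT.oplus_sub p pstar).symm
  have hsq := hp.eLpNorm_sq_le hd hΩ_compact hΩ_convex hQ hlam hρ hδ hL hc hε hc2 p hM
  have habs := QOT.abs_dualDeriv_apply_le_oplus hc2 hε p (p - pstar)
  rw [← hnorm] at hsq habs
  set n := (eLpNorm (QOT.oplus p - QOT.oplus pstar) 2 (P.prod Q)).toReal with hn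
  set g := ‖gradient (QOT.Gam P Q c ε) p‖ with hg
  set γ := QOT.gammaConst P Q δ lam Lam L ε with hγdef
  have hγ : 0 ≤ γ := QOT.gammaConst_nonneg P Q hδ.pos.le lam Lam L ε
  have hK : 0 < max M ε := hε.trans_le (le_max_right _ _)
  have hn0 : 0 ≤ n := ENNReal.toReal_nonneg
  have hg0 : 0 ≤ g := norm_nonneg _
  have hneg := (neg_le_abs (QOT.dualDeriv hc2 ε p (p - pstar))).trans habs
  have herr : n ≤ γ * max M ε * g := by
    rcases hn0.eq_or_lt with h | h
    · rw [← h]; positivity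
    · have : n * n ≤ γ * max M ε * g * n := by
        calc n * n = n ^ 2 := (sq n).symm
          _ ≤ γ * max M ε * (g * n) := hsq.trans (by gcongr)
          _ = _ := by ring
      exact le_of_mul_le_mul_right this h
  refine ⟨(QOT.hasFDerivAt_Gam hc2 hε p).differentiableAt, hinf, herr, ?_⟩
  have hval : (QOT.value P Q c ε).toReal ≤ QOT.Gam P Q c ε pstar := by
    have := EReal.toReal_le_toReal (hp.value_le_Gam hΩ_compact hQ hL hc hε) hbot
      (EReal.coe_ne_top _)
    simpa using this
  have htan := QOT.Gam_add_le hc2 hε p (-(p - pstar))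
  rw [show p + -(p - pstar) = pstar by abel, map_neg] at htan
  have hgap : (QOT.value P Q c ε).toReal - QOT.Gam P Q c ε p ≤ γ * max M ε * g ^ 2 := by
    have : g * n ≤ g * (γ * max M ε * g) := by gcongr
    linarith [show g * (γ * max M ε * g) = γ * max M ε * g ^ 2 by ring]
  rcases (mul_nonneg hγ hK.le).eq_or_lt with h | h
  · -- only the nonnegativity of the factor is at hand; for a zero factor the left side is `0`
    rw [← h, div_zero, zero_mul]; positivity
  · rwa [one_div, inv_mul_le_iff₀ h]
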